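/- **Theorem 1.** Let $K$ be a field of characteristic zero and let $K[x][\partial]$ be an Ore algebra: $\sigma\colon K[x]\to K[x]$ is a ring automorphism that fixes $K$ elementwise, $\delta\colon K[x]\to K[x]$ is a $K$-linear map with $\delta(uv)=\delta(u)v+\sigma(u)\delta(v)$, and multiplication is determined by $\partial u=\sigma(u)\partial+\delta(u)$ for $u\in K[x]$. The maps $\sigma,\delta$ extend uniquely to $K(x)$, which gives $K(x)[\partial]$. For a nonzero operator write $\deg_\partial$ for its order and $\operatorname{lc}$ for its leading coefficient, with coefficients written on the left. For a nonzero $L\in K[x][\partial]$, a polynomial $q\in K[x]$ dividing $\operatorname{lc}(L)$ is *removable from $L$ at order $n$* if there are $P\in K(x)[\partial]$ with $\deg_\partial P=n$ and $v,w\in K[x]$, $v\neq0$, $\gcd(q,w)=1$, such that $PL\in K[x][\partial]$ and $\sigma^{-n}(\operatorname{lc}(PL))=\frac{w}{vq}\operatorname{lc}(L)$. Let $a_0,\dots,a_{n-1}$ be algebraically independent over $K$ and put $F=K(a_0,\dots,a_{n-1})$. Extend $\sigma$ and $\delta$ $F$-linearly to $F[x]$, so that the $a_i$ are constants commuting with $\partial$.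 For nonzero $P,Q\in F[x][\partial]$, $\operatorname{lclm}(P,Q)$ denotes a nonzero common left multiple of $P$ and $Q$ in $F(x)[\partial]$ of least order, normalized so that its coefficients lie in $F[x]$ and have no common divisor there (it is unique up to a nonzero factor in $F$). Let $L\in K[x][\partial]$ be a nonzero operator of order $r$ and let $n\in\mathbb N$ (with $0\in\mathbb N$). Let $p\in K[x]$ be an irreducible factor of $\operatorname{lc}(L)$ of multiplicity $e$, and let $k\le e$ be maximal such that $p^k$ is removable from $L$ at order $n$. Let $A=a_0+a_1\partial+\cdots+a_{n-1}\partial^{n-1}+\partial^n$. Then $\operatorname{lclm}(L,A)$ exists, and the multiplicity of $\sigma^n(p)$ in $\operatorname{lc}(\operatorname{lclm}(L,A))$ is exactly $e-k$. -/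

import Mathlib

open Polynomial

/-- A skew derivation on a commutative ring `R`: an automorphism `σ` of `R` together with an
additive map `δ` that satisfies the skew Leibniz rule. -/
structure SkewDer (R : Type*) [CommRing R] where
  σ : R ≃+* R
  δ : R →+ R
  leibniz : ∀ u v : R, δ (u * v) = δ u * v + σ u * δ v

namespace SkewDer

variable {R : Type*} [CommRing R] (S : SkewDer R)

theorem δ_one : S.δ 1 = 0 := by
  have h := S.leibniz 1 1
  simpa using h

/-- Left multiplication by `∂`, in terms of left coefficients:
`∂ · ∑ uᵢ ∂ⁱ = ∑ (σ(uᵢ) ∂ⁱ⁺¹ + δ(uᵢ) ∂ⁱ)`. The variable of `R[X]` stands for `∂`. -/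
noncomputable def dmul : R[X] →+ R[X] where
  toFun f := f.sum fun i u => monomial (i + 1) (S.σ u) + monomial i (S.δ u)
  map_zero' := by simp
  map_add' f g := by
    rw [Polynomial.sum_add_index]
    · intro i; simp
    · intro i a b; simp only [map_add]; abel

/-- Left multiplication by `∑ cᵢ ∂ⁱ`, in terms of left coefficients:
`(∑ cᵢ ∂ⁱ) · g = ∑ cᵢ (∂ⁱ · g)`. -/
noncomputable def lmul (f g : R[X]) : R[X] :=
  f.sum fun i c => C c * S.dmul^[i] g

theorem lmul_zero_left (g : R[X]) : S.lmul 0 g = 0 := by simp [lmul]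

theorem lmul_add_left (f g h : R[X]) : S.lmul (f + g) h = S.lmul f h + S.lmul g h := by
  unfold lmul
  rw [Polynomial.sum_add_index]
  · intro i; simp
  · intro i a b; simp [add_mul]

theorem lmul_add_right (f g h : R[X]) : S.lmul f (g + h) = S.lmul f g + S.lmul f h := by
  simp only [lmul, iterate_map_add, mul_add, Polynomial.sum_add]

theorem lmul_zero_right (f : R[X]) : S.lmul f 0 = 0 := by
  simpa using S.lmul_add_right f 0 0

theorem dmul_monomial (i : ℕ) (u : R) :
    S.dmul (monomial i u) = monomial (i + 1) (S.σ u) + monomial i (S.δ u) := by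
  change ((monomial i u).sum fun i u => monomial (i + 1) (S.σ u) + monomial i (S.δ u)) = _
  rw [Polynomial.sum_monomial_index]
  simp

theorem lmul_monomial (i : ℕ) (c : R) (g : R[X]) :
    S.lmul (monomial i c) g = C c * S.dmul^[i] g := by
  rw [lmul, Polynomial.sum_monomial_index]
  simp

theorem dmul_C_mul (u : R) (h : R[X]) :
    S.dmul (C u * h) = C (S.σ u) * S.dmul h + C (S.δ u) * h := by
  induction h using Polynomial.induction_on' with
  | add p q hp hq => simp only [mul_add, map_add, hp, hq]; abel
  | monomial k v =>
    simp only [C_mul_monomial, dmul_monomial, map_mul, S.leibniz, mul_add, map_add]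
    abel

theorem dmul_iterate_one (i : ℕ) : S.dmul^[i] (1 : R[X]) = X ^ i := by
  induction i with
  | zero => simp
  | succ i ih =>
    rw [Function.iterate_succ_apply', ih, ← monomial_one_right_eq_X_pow, dmul_monomial]
    simp [δ_one, monomial_one_right_eq_X_pow]

theorem lmul_one_right (f : R[X]) : S.lmul f 1 = f := by
  induction f using Polynomial.induction_on' with
  | add p q hp hq => rw [lmul_add_left, hp, hq]
  | monomial k v => rw [lmul_monomial, dmul_iterate_one, C_mul_X_pow_eq_monomial]

theorem lmul_one_left (g : R[X]) : S.lmul 1 g = g := by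
  rw [← Polynomial.monomial_zero_one, lmul_monomial]
  simp

theorem lmul_C_mul (c : R) (g h : R[X]) : S.lmul (C c * g) h = C c * S.lmul g h := by
  induction g using Polynomial.induction_on' with
  | add p q hp hq => simp only [mul_add, lmul_add_left, hp, hq]
  | monomial k v => simp only [C_mul_monomial, lmul_monomial, C_mul, mul_assoc]

theorem lmul_dmul (g h : R[X]) : S.lmul (S.dmul g) h = S.dmul (S.lmul g h) := by
  induction g using Polynomial.induction_on' with
  | add p q hp hq => simp only [map_add, lmul_add_left, hp, hq]
  | monomial k v =>
    rw [dmul_monomial, lmul_monomial, dmul_C_mul, lmul_add_left,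
      lmul_monomial, lmul_monomial, Function.iterate_succ_apply']

theorem lmul_dmul_iterate (i : ℕ) (g h : R[X]) :
    S.lmul (S.dmul^[i] g) h = S.dmul^[i] (S.lmul g h) := by
  induction i with
  | zero => simp
  | succ i ih => simp only [Function.iterate_succ_apply', lmul_dmul, ih]

theorem lmul_lmul (f g h : R[X]) : S.lmul (S.lmul f g) h = S.lmul f (S.lmul g h) := by
  induction f using Polynomial.induction_on' with
  | add p q hp hq => simp only [lmul_add_left, hp, hq]
  | monomial k v => simp only [lmul_monomial, lmul_C_mul, lmul_dmul_iterate]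

section Frac

variable (Q : Type*) [Field Q] [Algebra R Q] [IsFractionRing R Q]

/-- The extension of `σ` to the fraction field. -/
noncomputable def fracσ : Q ≃+* Q := IsFractionRing.ringEquivOfRingEquiv S.σ

theorem fracσ_algebraMap (u : R) : S.fracσ Q (algebraMap R Q u) = algebraMap R Q (S.σ u) := by
  simp [fracσ]

/-- The extension of `δ` to the fraction field:
`δ(u/v) = (δ(u) - σ(u/v) δ(v)) / v`, for the fraction `u/v` that `IsLocalization.sec` picks. -/
noncomputable def fracδ (f : Q) : Q :=
  let s := IsLocalization.sec (nonZeroDivisors R) f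
  (algebraMap R Q (S.δ s.1) - S.fracσ Q f * algebraMap R Q (S.δ (s.2 : R))) /
    algebraMap R Q (s.2 : R)

variable {Q}

/-- Every representation as a fraction gives the same value. -/
theorem fracδ_eq [IsDomain R] {f : Q} {u v : R} (hv : v ≠ 0) (hf : f * algebraMap R Q v = algebraMap R Q u) :
    S.fracδ Q f = (algebraMap R Q (S.δ u) - S.fracσ Q f * algebraMap R Q (S.δ v)) /
      algebraMap R Q v := by
  unfold fracδ
  have hs := IsLocalization.sec_spec (nonZeroDivisors R) f
  generalize IsLocalization.sec (nonZeroDivisors R) f = s at *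
  obtain ⟨u', v', hv'⟩ := s
  replace hv' : v' ≠ 0 := nonZeroDivisors.ne_zero hv'
  dsimp only at hs ⊢
  have inj := IsFractionRing.injective R Q
  have hvQ : algebraMap R Q v ≠ 0 := by
    rwa [Ne, map_eq_zero_iff _ inj]
  have hvQ' : algebraMap R Q v' ≠ 0 := by
    rwa [Ne, map_eq_zero_iff _ inj]
  have e : u * v' = u' * v := by
    apply inj
    rw [map_mul, map_mul, ← hf, ← hs]; ring
  have e1 : S.δ u * v' + S.σ u * S.δ v' = S.δ u' * v + S.σ u' * S.δ v := by
    rw [← S.leibniz, ← S.leibniz, e]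
  have e2 : S.δ v * v' + S.σ v * S.δ v' = S.δ v' * v + S.σ v' * S.δ v := by
    rw [← S.leibniz, ← S.leibniz, mul_comm]
  have e3 : S.fracσ Q f * algebraMap R Q (S.σ v) = algebraMap R Q (S.σ u) := by
    rw [← fracσ_algebraMap, ← fracσ_algebraMap, ← map_mul, hf]
  have e4 : S.fracσ Q f * algebraMap R Q (S.σ v') = algebraMap R Q (S.σ u') := by
    rw [← fracσ_algebraMap, ← fracσ_algebraMap, ← map_mul, hs]
  replace e1 := congrArg (algebraMap R Q) e1
  replace e2 := congrArg (algebraMap R Q) e2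
  simp only [map_add, map_mul, ← e3, ← e4] at e1 e2
  rw [div_eq_div_iff hvQ' hvQ]
  linear_combination S.fracσ Q f * e2 - e1

theorem exists_frac [IsDomain R] (f : Q) : ∃ u v : R, v ≠ 0 ∧ f * algebraMap R Q v = algebraMap R Q u := by
  obtain ⟨⟨u, v⟩, h⟩ := IsLocalization.surj (nonZeroDivisors R) f
  exact ⟨u, v, nonZeroDivisors.ne_zero v.2, h⟩

variable (Q)

/-- The extension of a skew derivation from a domain to its fraction field. -/
noncomputable def frac [IsDomain R] : SkewDer Q where
  σ := S.fracσ Q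
  δ := AddMonoidHom.mk' (S.fracδ Q) (by
    intro f g
    have inj := IsFractionRing.injective R Q
    obtain ⟨u, v, hv, hf⟩ := exists_frac (R := R) f
    obtain ⟨u', v', hv', hg⟩ := exists_frac (R := R) g
    have hvQ : algebraMap R Q v ≠ 0 := by rwa [Ne, map_eq_zero_iff _ inj]
    have hvQ' : algebraMap R Q v' ≠ 0 := by rwa [Ne, map_eq_zero_iff _ inj]
    have h1 : f * algebraMap R Q (v * v') = algebraMap R Q (u * v') := by
      rw [map_mul, map_mul, ← hf]; ring
    have h2 : g * algebraMap R Q (v * v') = algebraMap R Q (u' * v) := by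
      rw [map_mul, map_mul, ← hg]; ring
    have h3 : (f + g) * algebraMap R Q (v * v') = algebraMap R Q (u * v' + u' * v) := by
      rw [map_add, ← h1, ← h2]; ring
    have hvv := mul_ne_zero hv hv'
    rw [S.fracδ_eq hvv h1, S.fracδ_eq hvv h2, S.fracδ_eq hvv h3, ← add_div, map_add, map_add,
      map_add]
    ring)
  leibniz f g := by
    change S.fracδ Q (f * g) = S.fracδ Q f * g + S.fracσ Q f * S.fracδ Q g
    have inj := IsFractionRing.injective R Q
    obtain ⟨u, v, hv, hf⟩ := exists_frac (R := R) f
    obtain ⟨u', v', hv', hg⟩ := exists_frac (R := R) g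
    have hvQ : algebraMap R Q v ≠ 0 := by rwa [Ne, map_eq_zero_iff _ inj]
    have hvQ' : algebraMap R Q v' ≠ 0 := by rwa [Ne, map_eq_zero_iff _ inj]
    have h3 : (f * g) * algebraMap R Q (v' * v) = algebraMap R Q (u * u') := by
      rw [map_mul, map_mul, ← hf, ← hg]; ring
    have e3 : S.fracσ Q f * algebraMap R Q (S.σ v) = algebraMap R Q (S.σ u) := by
      rw [← fracσ_algebraMap, ← fracσ_algebraMap, ← map_mul, hf]
    have e4 : S.fracσ Q g * algebraMap R Q (S.σ v') = algebraMap R Q (S.σ u') := by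
      rw [← fracσ_algebraMap, ← fracσ_algebraMap, ← map_mul, hg]
    have e5 : S.δ v * u' + S.σ v * S.δ u' = S.δ u' * v + S.σ u' * S.δ v := by
      rw [← S.leibniz, ← S.leibniz, mul_comm]
    replace e5 := congrArg (algebraMap R Q) e5
    simp only [map_add, map_mul, ← hg, ← e4] at e5
    rw [S.fracδ_eq (mul_ne_zero hv' hv) h3, S.fracδ_eq hv hf, S.fracδ_eq hv' hg, S.leibniz,
      S.leibniz]
    simp only [map_add, map_mul, ← e3, ← hg]
    field_simp
    linear_combination S.fracσ Q f * e5

theorem frac_σ_algebraMap [IsDomain R] (u : R) :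
    (S.frac Q).σ (algebraMap R Q u) = algebraMap R Q (S.σ u) :=
  S.fracσ_algebraMap Q u

theorem frac_δ_algebraMap [IsDomain R] (u : R) :
    (S.frac Q).δ (algebraMap R Q u) = algebraMap R Q (S.δ u) := by
  change S.fracδ Q _ = _
  rw [S.fracδ_eq (u := u) (one_ne_zero : (1 : R) ≠ 0) (by rw [map_one, mul_one])]
  simp [δ_one]

end Frac

end SkewDer

/-- The Ore polynomial ring `R[∂]` over `R` for a skew derivation `S = (σ, δ)`. An element
`∑ cᵢ ∂ⁱ`, with coefficients on the left, is stored as the polynomial with coefficients `cᵢ`. -/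
@[ext]
structure OrePoly {R : Type*} [CommRing R] (S : SkewDer R) where
  toPoly : R[X]

namespace OrePoly

variable {R : Type*} [CommRing R] {S : SkewDer R}

noncomputable instance : Zero (OrePoly S) := ⟨⟨0⟩⟩

noncomputable instance : Add (OrePoly S) := ⟨fun f g => ⟨f.toPoly + g.toPoly⟩⟩

noncomputable instance : Neg (OrePoly S) := ⟨fun f => ⟨-f.toPoly⟩⟩

noncomputable instance : Sub (OrePoly S) := ⟨fun f g => ⟨f.toPoly - g.toPoly⟩⟩

noncomputable instance : SMul ℕ (OrePoly S) := ⟨fun m f => ⟨m • f.toPoly⟩⟩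

noncomputable instance : SMul ℤ (OrePoly S) := ⟨fun m f => ⟨m • f.toPoly⟩⟩

theorem toPoly_injective : Function.Injective (toPoly : OrePoly S → R[X]) :=
  fun _ _ h => OrePoly.ext h

/-- As an additive group, the Ore polynomials are the polynomials. -/
noncomputable instance instAddCommGroup : AddCommGroup (OrePoly S) :=
  toPoly_injective.addCommGroup toPoly rfl (fun _ _ => rfl) (fun _ => rfl) (fun _ _ => rfl)
    (fun _ _ => rfl) (fun _ _ => rfl)

noncomputable instance : One (OrePoly S) := ⟨⟨1⟩⟩

noncomputable instance : Mul (OrePoly S) := ⟨fun f g => ⟨S.lmul f.toPoly g.toPoly⟩⟩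

@[simp] theorem toPoly_zero : (0 : OrePoly S).toPoly = 0 := rfl
@[simp] theorem toPoly_one : (1 : OrePoly S).toPoly = 1 := rfl
@[simp] theorem toPoly_add (f g : OrePoly S) : (f + g).toPoly = f.toPoly + g.toPoly := rfl
theorem toPoly_mul (f g : OrePoly S) : (f * g).toPoly = S.lmul f.toPoly g.toPoly := rfl

noncomputable instance instRing : Ring (OrePoly S) where
  __ := (inferInstance : AddCommGroup (OrePoly S))
  zero_mul f := OrePoly.ext (S.lmul_zero_left f.toPoly)
  mul_zero f := OrePoly.ext (S.lmul_zero_right f.toPoly)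
  left_distrib f g h := OrePoly.ext (S.lmul_add_right _ _ _)
  right_distrib f g h := OrePoly.ext (S.lmul_add_left _ _ _)
  mul_assoc f g h := OrePoly.ext (S.lmul_lmul _ _ _)
  one_mul f := OrePoly.ext (S.lmul_one_left f.toPoly)
  mul_one f := OrePoly.ext (S.lmul_one_right f.toPoly)

/-- The coefficient `u ∈ R`, as an operator of order zero. -/
noncomputable def coe (S : SkewDer R) (u : R) : OrePoly S := ⟨C u⟩

/-- The generator `∂`. -/
noncomputable def d (S : SkewDer R) : OrePoly S := ⟨X⟩

/-- The commutation rule `∂ u = σ(u) ∂ + δ(u)`. -/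
theorem d_mul_coe (u : R) : d S * coe S u = coe S (S.σ u) * d S + coe S (S.δ u) := by
  apply OrePoly.ext
  simp only [toPoly_add, toPoly_mul, d, coe, ← monomial_one_one_eq_X, ← monomial_zero_left,
    SkewDer.lmul_monomial, SkewDer.dmul_monomial, Function.iterate_one, Function.iterate_zero, id,
    monomial_mul_monomial, mul_add, zero_add, one_mul, mul_one]

/-- The order of an operator: its degree in `∂` (with value `0` at the zero operator). -/
noncomputable def order (L : OrePoly S) : ℕ := L.toPoly.natDegree

/-- The leading coefficient of an operator (with value `0` at the zero operator). -/
noncomputable def lc (L : OrePoly S) : R := L.toPoly.leadingCoeff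

/-- Apply a ring homomorphism to the coefficients of an operator. -/
noncomputable def map {R' : Type*} [CommRing R'] (S' : SkewDer R') (φ : R →+* R')
    (L : OrePoly S) : OrePoly S' := ⟨L.toPoly.map φ⟩

end OrePoly

/-- The data `(σ, δ)` of an Ore algebra `K[x][∂]` with constant field `K`: an automorphism `σ` of
`K[x]` that fixes `K`, and a `K`-linear map `δ` that satisfies the skew Leibniz rule.
The variable of `K[X]` is `x`. -/
structure OreData (K : Type*) [Field K] where
  σ : K[X] ≃ₐ[K] K[X]
  δ : K[X] →ₗ[K] K[X]
  leibniz : ∀ u v : K[X], δ (u * v) = δ u * v + σ u * δ v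

namespace OreData

variable {K : Type*} [Field K] (D : OreData K)

/-- The underlying skew derivation on `K[x]`. -/
noncomputable def skewDer : SkewDer K[X] where
  σ := D.σ.toRingEquiv
  δ := D.δ.toAddMonoidHom
  leibniz := D.leibniz

/-- The Ore algebra `K[x][∂]`. -/
abbrev Alg : Type _ := OrePoly D.skewDer

/-- The Ore algebra `K(x)[∂]`, for the extensions of `σ` and `δ` to `K(x)`. -/
abbrev RatAlg : Type _ := OrePoly (D.skewDer.frac (RatFunc K))

/-- The embedding of `K[x][∂]` into `K(x)[∂]`. -/
noncomputable def toRat (L : D.Alg) : D.RatAlg :=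
  L.map _ (algebraMap K[X] (RatFunc K))

/-- The polynomial `p` is removable from `L` at order `n`: some `P ∈ K(x)[∂]` of order `n` is such
that `PL` is an element `N` of `K[x][∂]` with `σ⁻ⁿ(lc N) = w / (v p) · lc L` for polynomials `v`
and `w`, where `w` is coprime to `p`. -/
def Removable (L : D.Alg) (p : K[X]) (n : ℕ) : Prop :=
  p ∣ L.lc ∧ ∃ (P : D.RatAlg) (N : D.Alg) (v w : K[X]),
    P ≠ 0 ∧ P.order = n ∧ v ≠ 0 ∧ IsCoprime p w ∧ P * D.toRat L = D.toRat N ∧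
      algebraMap K[X] (RatFunc K) (D.σ.symm^[n] N.lc) =
        algebraMap K[X] (RatFunc K) w / algebraMap K[X] (RatFunc K) (v * p) *
          algebraMap K[X] (RatFunc K) L.lc

/-- `M ∈ K(x)[∂]` is a common left multiple of `P` and `Q`. -/
def IsCommonLeftMultiple (M P Q : D.RatAlg) : Prop :=
  ∃ U V : D.RatAlg, M = U * P ∧ M = V * Q

/-- `IsLclm P Q M` says that `M = lclm(P, Q)`: among the nonzero common left multiples of `P` and
`Q` in `K(x)[∂]`, `M` has the least order, and the coefficients of `M` belong to `K[x]` and share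
no common divisor there. This determines `M` up to a factor in `K`. -/
def IsLclm (P Q M : D.Alg) : Prop :=
  M ≠ 0 ∧ D.IsCommonLeftMultiple (D.toRat M) (D.toRat P) (D.toRat Q) ∧
    (∀ N : D.RatAlg, N ≠ 0 → D.IsCommonLeftMultiple N (D.toRat P) (D.toRat Q) →
      M.order ≤ N.order) ∧
    M.toPoly.IsPrimitive

section BaseChange

variable (F : Type*) [Field F] [Algebra K F]

theorem aeval_map (q u : K[X]) :
    aeval (q.map (algebraMap K F)) (u.map (algebraMap K F)) =
      (aeval q u).map (algebraMap K F) := by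
  simp only [← Polynomial.comp_eq_aeval, Polynomial.map_comp]

theorem σ_eq_aeval (u : K[X]) : aeval (D.σ X) u = D.σ u := by
  have h := aeval_algHom_apply D.σ X u
  rwa [aeval_X_left_apply] at h

theorem σ_symm_eq_aeval (u : K[X]) : aeval (D.σ.symm X) u = D.σ.symm u := by
  have h := aeval_algHom_apply D.σ.symm X u
  rwa [aeval_X_left_apply] at h

/-- The `F`-linear extension of `σ` to `F[x]`. -/
noncomputable def baseσ : F[X] ≃ₐ[F] F[X] :=
  AlgEquiv.ofAlgHom (aeval ((D.σ X).map (algebraMap K F)))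
    (aeval ((D.σ.symm X).map (algebraMap K F)))
    (by
      ext1
      rw [AlgHom.comp_apply, aeval_X, aeval_map, σ_eq_aeval]
      simp)
    (by
      ext1
      rw [AlgHom.comp_apply, aeval_X, aeval_map, σ_symm_eq_aeval]
      simp)

/-- The `F`-linear extension of `δ` to `F[x]`. -/
noncomputable def baseδ : F[X] →ₗ[F] F[X] :=
  (Polynomial.basisMonomials F).constr F fun i => (D.δ (X ^ i)).map (algebraMap K F)

theorem baseσ_map (u : K[X]) :
    D.baseσ F (u.map (algebraMap K F)) = (D.σ u).map (algebraMap K F) := by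
  change aeval ((D.σ X).map (algebraMap K F)) (u.map (algebraMap K F)) = _
  rw [aeval_map, σ_eq_aeval]

theorem baseδ_X_pow (i : ℕ) : D.baseδ F (X ^ i) = (D.δ (X ^ i)).map (algebraMap K F) := by
  have h := (Polynomial.basisMonomials F).constr_basis F
    (fun i => (D.δ (X ^ i)).map (algebraMap K F)) i
  simp only [coe_basisMonomials, monomial_one_right_eq_X_pow] at h
  exact h

theorem baseδ_map (u : K[X]) :
    D.baseδ F (u.map (algebraMap K F)) = (D.δ u).map (algebraMap K F) := by
  induction u using Polynomial.induction_on' with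
  | add p q hp hq => simp only [Polynomial.map_add, map_add, hp, hq]
  | monomial k c =>
    rw [← C_mul_X_pow_eq_monomial, Polynomial.map_mul, map_C, Polynomial.map_pow, map_X,
      ← smul_eq_C_mul, ← smul_eq_C_mul, map_smul, map_smul, baseδ_X_pow, smul_eq_C_mul,
      smul_eq_C_mul, Polynomial.map_mul, map_C]

/-- The extension of the constant field from `K` to `F`: on `F[x]`, the maps `σ` and `δ` are
extended `F`-linearly. -/
noncomputable def baseChange : OreData F where
  σ := D.baseσ F
  δ := D.baseδ F
  leibniz u v := by
    induction u using Polynomial.induction_on' with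
    | add p q hp hq => simp only [add_mul, map_add, hp, hq]; ring
    | monomial i a =>
      induction v using Polynomial.induction_on' with
      | add p q hp hq => simp only [mul_add, map_add, hp, hq]; ring
      | monomial j b =>
        have key : D.baseδ F (X ^ i * X ^ j) =
            D.baseδ F (X ^ i) * X ^ j + D.baseσ F (X ^ i) * D.baseδ F (X ^ j) := by
          have h1 := D.baseδ_map F (X ^ i * X ^ j)
          have h2 := D.baseσ_map F (X ^ i)
          rw [D.leibniz] at h1
          simp only [Polynomial.map_mul, Polynomial.map_add, Polynomial.map_pow, map_X] at h1 h2
          rw [h1, h2, baseδ_X_pow, baseδ_X_pow]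
        rw [← C_mul_X_pow_eq_monomial, ← C_mul_X_pow_eq_monomial, ← smul_eq_C_mul,
          ← smul_eq_C_mul, smul_mul_smul_comm, map_smul, map_smul, map_smul, map_smul, key]
        simp only [smul_eq_C_mul, C_mul]
        ring

/-- The embedding of `K[x][∂]` into `F[x][∂]`. -/
noncomputable def toBase (L : D.Alg) : (D.baseChange F).Alg :=
  L.map _ (Polynomial.mapRingHom (algebraMap K F))

end BaseChange

/-- The operator `a₀ + a₁ ∂ + ⋯ + aₙ₋₁ ∂ⁿ⁻¹ + ∂ⁿ` with constant coefficients `aᵢ ∈ K`. -/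
noncomputable def constOp {n : ℕ} (a : Fin n → K) : D.Alg :=
  ∑ i : Fin n, OrePoly.coe D.skewDer (C (a i)) * OrePoly.d D.skewDer ^ (i : ℕ) +
    OrePoly.d D.skewDer ^ n

end OreData

/-- The field `K(a₀, …, aₙ₋₁)` of rational functions in `n` indeterminates. -/
abbrev GenericField (K : Type*) [Field K] (n : ℕ) : Type _ :=
  FractionRing (MvPolynomial (Fin n) K)

/-- The indeterminates `a₀, …, aₙ₋₁`, as elements of `K(a₀, …, aₙ₋₁)`. -/
noncomputable def genericConst (K : Type*) [Field K] (n : ℕ) (i : Fin n) : GenericField K n :=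
  algebraMap (MvPolynomial (Fin n) K) (GenericField K n) (MvPolynomial.X i)

/-!
Over the field of fractions, the left multiples of `L` of order at most `r + n`, where `r` is the
order of `L`, form a vector space of dimension `n + 1`. Those with coefficients in `K[x]` form a
lattice in it, and `K[x]` is a principal ideal domain, so the lattice has a triangular basis
`B 0, …, B n` (`SkewDer.IsAdapted`): `B i` has order `r + i`, and its leading coefficient divides
the coefficient of `∂ ^ (r + i)` in every left multiple of order at most `r + i`. By the definition
of removability, `q = σⁿ(p)` has multiplicity exactly `e - k` in the leading coefficient of `B n`
(`OreData.emultiplicity_coeff_of_isGreatest`).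

The `B i` remain a basis of the corresponding lattice over `F[x]`, because the coordinates of a left
multiple with respect to linear functionals `F → K` are left multiples over `K`
(`SkewDer.IsAdapted.baseChange`). Hence `M = lclm(L, A)` is a combination `∑ cᵢ Bᵢ` with
`cᵢ ∈ F[x]`; its order is at most `r + n`, since `L, ∂L, …, ∂ⁿL` are linearly dependent modulo `A`.
It remains to see that `q` does not divide `cₙ`.

The coefficients of `A` are constants that commute with `∂`, so that right divisibility by `A` is
ordinary divisibility of polynomials in `∂`. If `q` divided `cₙ`, then, modulo `q`, the
combination `∑ cᵢ Bᵢ` over `i < n` would be divisible by `A`. The operators `B 0, …, B (n - 1)` are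
linearly independent modulo `q`, because their lattice is saturated, and `A` is generic, so their
remainders modulo `A` are linearly independent modulo `q` as well (`dvd_of_generic_dvd`):
the determinant of the remainders is a polynomial in the `aᵢ`, and it does not vanish modulo `q` at
the coefficients of `∏ (X - tⱼ)` when the points `tⱼ` separate the operators
(`not_dvd_det_remainderMatrix`). Therefore `q` divides all `cᵢ`, and `M` is not primitive.
-/

/-! ### Degrees and leading coefficients of products of operators -/

namespace SkewDer

section Degree

variable {R : Type*} [CommRing R] (S : SkewDer R)

theorem coeff_dmul_succ (f : R[X]) (j : ℕ) :
    (S.dmul f).coeff (j + 1) = S.σ (f.coeff j) + S.δ (f.coeff (j + 1)) := by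
  induction f using Polynomial.induction_on' with
  | add p q hp hq => simp only [map_add, coeff_add, hp, hq]; abel
  | monomial k v =>
    rw [dmul_monomial]
    simp only [coeff_add, coeff_monomial, Nat.add_right_cancel_iff]
    split_ifs <;> simp

theorem natDegree_dmul {f : R[X]} (hf : f ≠ 0) : (S.dmul f).natDegree = f.natDegree + 1 := by
  refine natDegree_eq_of_le_of_coeff_ne_zero ?_ ?_
  · refine natDegree_le_iff_coeff_eq_zero.2 fun j hj => ?_
    obtain ⟨j, rfl⟩ : ∃ i, j = i + 1 := ⟨j - 1, by omega⟩
    rw [coeff_dmul_succ, coeff_eq_zero_of_natDegree_lt (by omega),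
      coeff_eq_zero_of_natDegree_lt (by omega), map_zero, map_zero, add_zero]
  · rw [coeff_dmul_succ, coeff_eq_zero_of_natDegree_lt (Nat.lt_succ_self _), map_zero, add_zero]
    simpa using hf

theorem leadingCoeff_dmul (f : R[X]) : (S.dmul f).leadingCoeff = S.σ f.leadingCoeff := by
  rcases eq_or_ne f 0 with rfl | hf
  · simp
  · rw [leadingCoeff, natDegree_dmul S hf, coeff_dmul_succ,
      coeff_eq_zero_of_natDegree_lt (Nat.lt_succ_self _), map_zero, add_zero, leadingCoeff]

theorem leadingCoeff_iterate_dmul (f : R[X]) (m : ℕ) :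
    (S.dmul^[m] f).leadingCoeff = S.σ^[m] f.leadingCoeff := by
  induction m with
  | zero => rfl
  | succ m ih => simp only [Function.iterate_succ_apply', leadingCoeff_dmul, ih]

theorem iterate_σ_ne_zero {u : R} (hu : u ≠ 0) (m : ℕ) : S.σ^[m] u ≠ 0 := by
  induction m with
  | zero => exact hu
  | succ m ih => simpa only [Function.iterate_succ_apply', ne_eq, map_eq_zero_iff _ S.σ.injective]

theorem iterate_dmul_ne_zero {f : R[X]} (hf : f ≠ 0) (m : ℕ) : S.dmul^[m] f ≠ 0 := by
  rw [← leadingCoeff_ne_zero, leadingCoeff_iterate_dmul]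
  exact S.iterate_σ_ne_zero (leadingCoeff_ne_zero.2 hf) m

theorem natDegree_iterate_dmul {f : R[X]} (hf : f ≠ 0) (m : ℕ) :
    (S.dmul^[m] f).natDegree = f.natDegree + m := by
  induction m with
  | zero => rfl
  | succ m ih =>
    rw [Function.iterate_succ_apply', natDegree_dmul S (S.iterate_dmul_ne_zero hf m), ih, add_assoc]

theorem left_ne_zero_of_lmul {f g : R[X]} (h : S.lmul f g ≠ 0) : f ≠ 0 := by
  rintro rfl
  exact h (S.lmul_zero_left g)

variable [IsDomain R]

theorem natDegree_leadingCoeff_lmul {f g : R[X]} (hf : f ≠ 0) (hg : g ≠ 0) :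
    (S.lmul f g).natDegree = g.natDegree + f.natDegree ∧
      (S.lmul f g).leadingCoeff = f.leadingCoeff * S.σ^[f.natDegree] g.leadingCoeff := by
  have hc : (S.lmul f g).coeff (g.natDegree + f.natDegree) =
      f.leadingCoeff * S.σ^[f.natDegree] g.leadingCoeff := by
    rw [lmul, sum_def, finsetSum_coeff, Finset.sum_eq_single f.natDegree]
    · rw [coeff_C_mul, ← leadingCoeff_iterate_dmul, leadingCoeff, leadingCoeff,
        natDegree_iterate_dmul S hg]
    · intro i hi hne
      have : i ≤ f.natDegree := le_natDegree_of_mem_supp i hi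
      have h0 : (S.dmul^[i] g).natDegree < g.natDegree + f.natDegree := by
        rw [natDegree_iterate_dmul S hg]
        omega
      rw [coeff_C_mul, coeff_eq_zero_of_natDegree_lt h0, mul_zero]
    · intro h
      rw [notMem_support_iff.1 h, map_zero, zero_mul, coeff_zero]
  have hd : (S.lmul f g).natDegree = g.natDegree + f.natDegree := by
    refine natDegree_eq_of_le_of_coeff_ne_zero ?_ ?_
    · refine natDegree_sum_le_of_forall_le _ _ fun i hi => ?_
      refine (natDegree_C_mul_le _ _).trans ?_
      rw [natDegree_iterate_dmul S hg]
      have : i ≤ f.natDegree := le_natDegree_of_mem_supp i hi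
      omega
    · rw [hc]
      exact mul_ne_zero (leadingCoeff_ne_zero.2 hf)
        (S.iterate_σ_ne_zero (leadingCoeff_ne_zero.2 hg) _)
  exact ⟨hd, by rw [← hc, ← hd, leadingCoeff]⟩

theorem lmul_ne_zero {f g : R[X]} (hf : f ≠ 0) (hg : g ≠ 0) : S.lmul f g ≠ 0 := by
  rw [← leadingCoeff_ne_zero, (S.natDegree_leadingCoeff_lmul hf hg).2]
  exact mul_ne_zero (leadingCoeff_ne_zero.2 hf)
    (S.iterate_σ_ne_zero (leadingCoeff_ne_zero.2 hg) _)

end Degree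

/-! ### Change of coefficients and operators with constant coefficients -/

section Map

variable {R R' : Type*} [CommRing R] [CommRing R'] {S : SkewDer R} {S' : SkewDer R'}
  {φ : R →+* R'}

theorem map_dmul (hσ : ∀ u, S'.σ (φ u) = φ (S.σ u)) (hδ : ∀ u, S'.δ (φ u) = φ (S.δ u))
    (f : R[X]) : (S.dmul f).map φ = S'.dmul (f.map φ) := by
  induction f using Polynomial.induction_on' with
  | add p q hp hq => simp only [map_add, Polynomial.map_add, hp, hq]
  | monomial k v => simp only [dmul_monomial, Polynomial.map_add, map_monomial, hσ, hδ]

theorem map_iterate_dmul (hσ : ∀ u, S'.σ (φ u) = φ (S.σ u)) (hδ : ∀ u, S'.δ (φ u) = φ (S.δ u))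
    (f : R[X]) (m : ℕ) : (S.dmul^[m] f).map φ = S'.dmul^[m] (f.map φ) := by
  induction m with
  | zero => rfl
  | succ m ih => simp only [Function.iterate_succ_apply', map_dmul hσ hδ, ih]

theorem map_lmul (hσ : ∀ u, S'.σ (φ u) = φ (S.σ u)) (hδ : ∀ u, S'.δ (φ u) = φ (S.δ u))
    (f g : R[X]) : (S.lmul f g).map φ = S'.lmul (f.map φ) (g.map φ) := by
  induction f using Polynomial.induction_on' with
  | add p q hp hq => simp only [lmul_add_left, Polynomial.map_add, hp, hq]
  | monomial k v =>
    simp only [lmul_monomial, Polynomial.map_mul, map_C, map_monomial, map_iterate_dmul hσ hδ]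

end Map

section

variable {R : Type*} [CommRing R] (S : SkewDer R)

theorem lmul_C (c : R) (g : R[X]) : S.lmul (C c) g = C c * g := by
  rw [← monomial_zero_left, lmul_monomial, monomial_zero_left]
  rfl

theorem lmul_X (g : R[X]) : S.lmul X g = S.dmul g := by
  rw [← monomial_one_one_eq_X, lmul_monomial, C_1, one_mul]
  rfl

/-- Multiplication by an operator whose coefficients are constants is multiplication of ordinary
polynomials. -/
theorem lmul_eq_mul_of_const {A : R[X]} (hσ : ∀ i, S.σ (A.coeff i) = A.coeff i)
    (hδ : ∀ i, S.δ (A.coeff i) = 0) (f : R[X]) : S.lmul f A = f * A := by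
  have h : ∀ m, S.dmul^[m] A = X ^ m * A := by
    have h1 : ∀ m, S.dmul (X ^ m * A) = X ^ (m + 1) * A := by
      intro m
      ext j
      rcases j with _ | j
      · have hδ0 : ∀ B : R[X], (S.dmul B).coeff 0 = S.δ (B.coeff 0) := by
          intro B
          induction B using Polynomial.induction_on' with
          | add p q hp hq => simp only [map_add, coeff_add, hp, hq]
          | monomial k v =>
            rw [dmul_monomial]
            simp only [coeff_add, coeff_monomial]
            split_ifs <;> simp_all
        rw [hδ0, coeff_X_pow_mul', coeff_X_pow_mul']
        split_ifs <;> simp_all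
      · rw [coeff_dmul_succ]
        simp only [coeff_X_pow_mul', add_le_add_iff_right, Nat.add_sub_add_right]
        split_ifs <;> simp [hσ, hδ]
    intro m
    induction m with
    | zero => simp
    | succ m ih => rw [Function.iterate_succ_apply', ih, h1]
  induction f using Polynomial.induction_on' with
  | add p q hp hq => simp only [lmul_add_left, add_mul, hp, hq]
  | monomial k v =>
    rw [lmul_monomial, h, ← mul_assoc, C_mul_X_pow_eq_monomial]

end

/-! ### Left multiples up to denominators -/

section LeftMultiple

variable {R : Type*} [CommRing R]

/-- `N` belongs to the left ideal that `L` generates over the fraction field of `R`. This is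
expressed without fractions: some nonzero `s ∈ R` makes `s N` a left multiple of `L` over `R`. -/
def IsLeftMultiple (S : SkewDer R) (L N : R[X]) : Prop :=
  ∃ s : R, s ≠ 0 ∧ ∃ P : R[X], C s * N = S.lmul P L

namespace IsLeftMultiple

variable {S : SkewDer R} {L N N' : R[X]}

theorem lmul [Nontrivial R] (S : SkewDer R) (P L : R[X]) : S.IsLeftMultiple L (S.lmul P L) :=
  ⟨1, one_ne_zero, P, by simp⟩

theorem iterate_dmul [Nontrivial R] (S : SkewDer R) (L : R[X]) (m : ℕ) :
    S.IsLeftMultiple L (S.dmul^[m] L) := by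
  have h := IsLeftMultiple.lmul S (monomial m 1) L
  rwa [lmul_monomial, C_1, one_mul] at h

theorem zero [Nontrivial R] (S : SkewDer R) (L : R[X]) : S.IsLeftMultiple L 0 := by
  simpa only [lmul_zero_left] using IsLeftMultiple.lmul S 0 L

theorem C_mul (h : S.IsLeftMultiple L N) (c : R) : S.IsLeftMultiple L (C c * N) := by
  obtain ⟨s, hs, P, e⟩ := h
  exact ⟨s, hs, C c * P, by rw [lmul_C_mul, ← e]; ring⟩

variable [IsDomain R]

theorem add (h : S.IsLeftMultiple L N) (h' : S.IsLeftMultiple L N') :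
    S.IsLeftMultiple L (N + N') := by
  obtain ⟨s, hs, P, e⟩ := h
  obtain ⟨s', hs', P', e'⟩ := h'
  exact ⟨s * s', mul_ne_zero hs hs', C s' * P + C s * P', by
    rw [lmul_add_left, lmul_C_mul, lmul_C_mul, ← e, ← e', Polynomial.C_mul]; ring⟩

theorem sub (h : S.IsLeftMultiple L N) (h' : S.IsLeftMultiple L N') :
    S.IsLeftMultiple L (N - N') := by
  have := h.add (h'.C_mul (-1))
  simpa [sub_eq_add_neg] using this

theorem of_C_mul {c : R} (hc : c ≠ 0) (h : S.IsLeftMultiple L (C c * N)) :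
    S.IsLeftMultiple L N := by
  obtain ⟨s, hs, P, e⟩ := h
  exact ⟨s * c, mul_ne_zero hs hc, P, by rw [← e, Polynomial.C_mul, mul_assoc]⟩

theorem natDegree_le (hL : L ≠ 0) (h : S.IsLeftMultiple L N) (hN : N ≠ 0) :
    L.natDegree ≤ N.natDegree := by
  obtain ⟨s, hs, P, e⟩ := h
  have h0 : S.lmul P L ≠ 0 := by
    rw [← e]; exact mul_ne_zero (C_ne_zero.2 hs) hN
  have h1 := (S.natDegree_leadingCoeff_lmul (S.left_ne_zero_of_lmul h0) hL).1
  rw [← e, natDegree_C_mul hs] at h1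
  omega

theorem eq_zero_of_degree_lt (hL : L ≠ 0) (h : S.IsLeftMultiple L N)
    (hN : N.degree < (L.natDegree : ℕ)) : N = 0 := by
  by_contra h0
  have h1 := h.natDegree_le hL h0
  rw [← natDegree_lt_iff_degree_lt h0] at hN
  omega

/-- The denominator of a left multiple of bounded order can be chosen independently of the multiple:
a product of images of the leading coefficient of `L` under powers of `σ` suffices, by division with
remainder. If `L` has coefficients in `K[x]`, this denominator does not involve further constants,
whatever the constants in the left multiple. -/
theorem exists_prod_mul_eq (hL : L ≠ 0) (m : ℕ) (h : S.IsLeftMultiple L N)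
    (hN : N.degree < (L.natDegree + m : ℕ)) :
    ∃ Q : R[X], C (∏ i ∈ Finset.range m, S.σ^[i] L.leadingCoeff) * N = S.lmul Q L := by
  induction m generalizing N with
  | zero => exact ⟨0, by rw [h.eq_zero_of_degree_lt hL hN, mul_zero, lmul_zero_left]⟩
  | succ m ih =>
    set c := N.coeff (L.natDegree + m)
    have hcoef : (S.dmul^[m] L).coeff (L.natDegree + m) = S.σ^[m] L.leadingCoeff := by
      rw [← S.leadingCoeff_iterate_dmul, leadingCoeff, S.natDegree_iterate_dmul hL]
    obtain ⟨Q, hQ⟩ := ih (N := C (S.σ^[m] L.leadingCoeff) * N - C c * S.dmul^[m] L)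
      ((h.C_mul _).sub ((iterate_dmul S L m).C_mul c)) (by
        rw [degree_lt_iff_coeff_zero] at hN ⊢
        intro j hj
        rw [coeff_sub, coeff_C_mul, coeff_C_mul]
        rcases hj.eq_or_lt with rfl | hj
        · rw [hcoef]; ring
        · rw [hN j (by omega), coeff_eq_zero_of_natDegree_lt (by
            rw [S.natDegree_iterate_dmul hL]; omega)]
          ring)
    refine ⟨Q + monomial m ((∏ i ∈ Finset.range m, S.σ^[i] L.leadingCoeff) * c), ?_⟩
    rw [lmul_add_left, ← hQ, lmul_monomial, Finset.prod_range_succ, Polynomial.C_mul,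
      Polynomial.C_mul]
    ring

end IsLeftMultiple

end LeftMultiple

end SkewDer

/-! ### Families of left multiples with minimal leading coefficients -/

namespace SkewDer

section Adapted

variable {R : Type*} [CommRing R]

/-- A sequence of left multiples `B i` of `L` of order at most `ord L + i` such that the
coefficient of `∂ ^ (ord L + i)` in `B i` divides the same coefficient of every left multiple of
`L` of order at most `ord L + i`. Left multiples are taken over the fraction field, but only those
with coefficients in `R` are considered. -/
structure IsAdapted (S : SkewDer R) (L : R[X]) (B : ℕ → R[X]) : Prop where
  isLeftMultiple : ∀ i, S.IsLeftMultiple L (B i)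
  degree_lt : ∀ i, (B i).degree < (L.natDegree + (i + 1) : ℕ)
  dvd : ∀ i N, S.IsLeftMultiple L N → N.degree < (L.natDegree + (i + 1) : ℕ) →
    (B i).coeff (L.natDegree + i) ∣ N.coeff (L.natDegree + i)

namespace IsAdapted

variable {S : SkewDer R} {L : R[X]} {B : ℕ → R[X]}

theorem sub_degree_lt (h : S.IsAdapted L B) {N : R[X]} {m : ℕ} {c : R}
    (hN : N.degree < (L.natDegree + (m + 1) : ℕ))
    (hc : N.coeff (L.natDegree + m) = c * (B m).coeff (L.natDegree + m)) :
    (N - C c * B m).degree < (L.natDegree + m : ℕ) := by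
  have hB := h.degree_lt m
  rw [degree_lt_iff_coeff_zero] at hN hB ⊢
  intro j hj
  rw [coeff_sub, coeff_C_mul]
  rcases hj.eq_or_lt with rfl | hj
  · rw [hc, sub_self]
  · rw [hN j (by omega), hB j (by omega), mul_zero, sub_zero]

theorem sum_degree_lt (h : S.IsAdapted L B) (m : ℕ) (c : ℕ → R) :
    (∑ i ∈ Finset.range m, C (c i) * B i).degree < (L.natDegree + m : ℕ) := by
  rw [degree_lt_iff_coeff_zero]
  intro j hj
  rw [finsetSum_coeff]
  refine Finset.sum_eq_zero fun i hi => ?_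
  have h1 := (degree_lt_iff_coeff_zero _ _).1 (h.degree_lt i) j
    (by have := Finset.mem_range.1 hi; omega)
  rw [coeff_C_mul, h1, mul_zero]

variable [IsDomain R]

theorem dvd_iterate_σ (h : S.IsAdapted L B) (hL : L ≠ 0) (i : ℕ) :
    (B i).coeff (L.natDegree + i) ∣ S.σ^[i] L.leadingCoeff := by
  have h1 := h.dvd i _ (IsLeftMultiple.iterate_dmul S L i) (by
    rw [← natDegree_lt_iff_degree_lt (S.iterate_dmul_ne_zero hL i), S.natDegree_iterate_dmul hL]
    omega)
  rwa [← S.leadingCoeff_iterate_dmul, leadingCoeff, S.natDegree_iterate_dmul hL]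

theorem coeff_ne_zero (h : S.IsAdapted L B) (hL : L ≠ 0) (i : ℕ) :
    (B i).coeff (L.natDegree + i) ≠ 0 :=
  ne_zero_of_dvd_ne_zero (S.iterate_σ_ne_zero (leadingCoeff_ne_zero.2 hL) i)
    (h.dvd_iterate_σ hL i)

theorem natDegree_eq (h : S.IsAdapted L B) (hL : L ≠ 0) (i : ℕ) :
    (B i).natDegree = L.natDegree + i := by
  have h0 : B i ≠ 0 := fun h1 => h.coeff_ne_zero hL i (by rw [h1, coeff_zero])
  have h1 := h.degree_lt i
  rw [← natDegree_lt_iff_degree_lt h0] at h1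
  exact natDegree_eq_of_le_of_coeff_ne_zero (by omega) (h.coeff_ne_zero hL i)

/-- The left multiples of `L` of order less than `ord L + m` are the `R`-linear combinations of
`B 0, …, B (m - 1)`. -/
theorem exists_eq_sum (h : S.IsAdapted L B) (hL : L ≠ 0) (m : ℕ) {N : R[X]}
    (hN : S.IsLeftMultiple L N) (hd : N.degree < (L.natDegree + m : ℕ)) :
    ∃ c : ℕ → R, N = ∑ i ∈ Finset.range m, C (c i) * B i := by
  induction m generalizing N with
  | zero => exact ⟨0, by simpa using hN.eq_zero_of_degree_lt hL hd⟩
  | succ m ih =>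
    obtain ⟨d, hd'⟩ := h.dvd m N hN hd
    obtain ⟨c, hc⟩ := ih (hN.sub ((h.isLeftMultiple m).C_mul d))
      (h.sub_degree_lt hd (by rw [hd', mul_comm]))
    refine ⟨Function.update c m d, ?_⟩
    rw [Finset.sum_range_succ, Function.update_self, ← sub_eq_iff_eq_add, hc]
    refine Finset.sum_congr rfl fun i hi => ?_
    rw [Function.update_of_ne (Finset.mem_range.1 hi).ne]

/-- The operators `B 0, …, B (m - 1)` remain linearly independent modulo every nonzero `q ∈ R`: a
left multiple of `L` that is divisible by `q` stays a left multiple of `L` after division. -/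
theorem dvd_of_sum_eq (h : S.IsAdapted L B) (hL : L ≠ 0) {q : R} (hq : q ≠ 0) (m : ℕ)
    {c : ℕ → R} {G : R[X]} (hc : ∑ i ∈ Finset.range m, C (c i) * B i = C q * G) :
    ∀ i < m, q ∣ c i := by
  induction m generalizing G with
  | zero => intro i hi; omega
  | succ m ih =>
    have hmem : ∀ l, S.IsLeftMultiple L (∑ i ∈ Finset.range l, C (c i) * B i) := by
      intro l
      induction l with
      | zero => simpa using IsLeftMultiple.zero S L
      | succ l ih =>
        rw [Finset.sum_range_succ]
        exact ih.add ((h.isLeftMultiple l).C_mul _)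
    have hG : S.IsLeftMultiple L G := IsLeftMultiple.of_C_mul hq (hc ▸ hmem (m + 1))
    have hdeg : G.degree < (L.natDegree + (m + 1) : ℕ) := by
      have h1 := h.sum_degree_lt (m + 1) c
      rwa [hc, degree_mul, degree_C hq, zero_add] at h1
    obtain ⟨d, hd⟩ := h.dvd m G hG hdeg
    have hcm : c m = q * d := by
      have h1 := congrArg (fun f : R[X] => f.coeff (L.natDegree + m)) hc
      simp only [Finset.sum_range_succ, coeff_add, coeff_C_mul] at h1
      rw [(degree_lt_iff_coeff_zero _ _).1 (h.sum_degree_lt m c) _ le_rfl, zero_add, hd] at h1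
      refine mul_right_cancel₀ (h.coeff_ne_zero hL m) ?_
      rw [h1]; ring
    have h2 : ∑ i ∈ Finset.range m, C (c i) * B i = C q * (G - C d * B m) := by
      rw [Finset.sum_range_succ, hcm, C_mul] at hc
      rw [mul_sub, ← hc]; ring
    intro i hi
    rcases Nat.lt_succ_iff_lt_or_eq.1 hi with hi | rfl
    · exact ih h2 i hi
    · exact ⟨d, hcm⟩

end IsAdapted

theorem exists_isAdapted [IsDomain R] [IsPrincipalIdealRing R] (S : SkewDer R) (L : R[X]) :
    ∃ B, S.IsAdapted L B := by
  -- the coefficients of `∂ ^ (ord L + i)` form an ideal, whose generator is attained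
  have key : ∀ i : ℕ, ∃ b : R[X], S.IsLeftMultiple L b ∧
      b.degree < (L.natDegree + (i + 1) : ℕ) ∧
      ∀ N, S.IsLeftMultiple L N → N.degree < (L.natDegree + (i + 1) : ℕ) →
        b.coeff (L.natDegree + i) ∣ N.coeff (L.natDegree + i) := by
    intro i
    let I : Ideal R :=
      { carrier := {u | ∃ N, S.IsLeftMultiple L N ∧ N.degree < (L.natDegree + (i + 1) : ℕ) ∧
          N.coeff (L.natDegree + i) = u}
        add_mem' := by
          rintro _ _ ⟨N, hN, hd, rfl⟩ ⟨N', hN', hd', rfl⟩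
          exact ⟨N + N', hN.add hN', (degree_add_le _ _).trans_lt (max_lt hd hd'), coeff_add ..⟩
        zero_mem' := ⟨0, IsLeftMultiple.zero S L, by simp, coeff_zero _⟩
        smul_mem' := by
          rintro c _ ⟨N, hN, hd, rfl⟩
          refine ⟨C c * N, hN.C_mul c, ?_, by rw [coeff_C_mul, smul_eq_mul]⟩
          rw [← smul_eq_C_mul]
          exact (degree_smul_le c N).trans_lt hd }
    obtain ⟨b, hb, hd, hbu⟩ := Submodule.IsPrincipal.generator_mem I
    refine ⟨b, hb, hd, fun N hN hd' => ?_⟩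
    rw [hbu]
    exact (Submodule.IsPrincipal.mem_iff_generator_dvd I).1 ⟨N, hN, hd', rfl⟩
  choose B h1 h2 h3 using key
  exact ⟨B, h1, h2, h3⟩

end Adapted

end SkewDer

/-! ### Extension of the field of constants -/

namespace Polynomial

section MapCoeff

variable {R R' : Type*} [CommRing R] [CommRing R']

/-- Apply an additive map to the coefficients of a polynomial. -/
noncomputable def mapCoeff (φ : R →+ R') : R[X] →+ R'[X] where
  toFun f := f.sum fun i a => monomial i (φ a)
  map_zero' := by simp
  map_add' f g := by
    rw [sum_add_index]
    · intro i; simp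
    · intro i a b; simp

theorem mapCoeff_monomial (φ : R →+ R') (i : ℕ) (a : R) :
    mapCoeff φ (monomial i a) = monomial i (φ a) := by
  change (monomial i a).sum (fun i a => monomial i (φ a)) = _
  rw [sum_monomial_index]
  simp

theorem coeff_mapCoeff (φ : R →+ R') (f : R[X]) (i : ℕ) :
    (mapCoeff φ f).coeff i = φ (f.coeff i) := by
  induction f using Polynomial.induction_on' with
  | add p q hp hq => simp only [map_add, coeff_add, hp, hq]
  | monomial k v =>
    rw [mapCoeff_monomial, coeff_monomial, coeff_monomial]
    split_ifs <;> simp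

theorem degree_mapCoeff_le (φ : R →+ R') (f : R[X]) : (mapCoeff φ f).degree ≤ f.degree := by
  rw [degree_le_iff_coeff_zero]
  intro m hm
  rw [coeff_mapCoeff, coeff_eq_zero_of_degree_lt hm, map_zero]

/-- Semilinearity of `φ` over `ι` passes to the coefficientwise map. -/
theorem mapCoeff_map_mul {φ : R →+ R'} {ι : R' →+* R} (h : ∀ a b, φ (ι a * b) = a * φ b)
    (f : R'[X]) (g : R[X]) : mapCoeff φ (f.map ι * g) = f * mapCoeff φ g := by
  induction f using Polynomial.induction_on' with
  | add p q hp hq => simp only [Polynomial.map_add, add_mul, map_add, hp, hq]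
  | monomial k v =>
    induction g using Polynomial.induction_on' with
    | add p q hp hq => simp only [mul_add, map_add, hp, hq]
    | monomial l w =>
      simp only [map_monomial, monomial_mul_monomial, mapCoeff_monomial, h]

end MapCoeff

section Dual

variable {K F : Type*} [Field K] [Field F] [Algebra K F]

theorem mapCoeff_dual_map_mul (φ : Module.Dual K F) (f : K[X]) (g : F[X]) :
    mapCoeff φ.toAddMonoidHom (f.map (algebraMap K F) * g) =
      f * mapCoeff φ.toAddMonoidHom g :=
  mapCoeff_map_mul (φ := φ.toAddMonoidHom)
    (fun a b => by
      change φ (algebraMap K F a * b) = a * φ b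
      rw [← Algebra.smul_def, map_smul, smul_eq_mul]) f g

theorem mapCoeff_mapCoeff_dual_map_mul (φ : Module.Dual K F) (f : K[X][X]) (g : F[X][X]) :
    mapCoeff (mapCoeff φ.toAddMonoidHom) (f.map (mapRingHom (algebraMap K F)) * g) =
      f * mapCoeff (mapCoeff φ.toAddMonoidHom) g :=
  mapCoeff_map_mul (ι := mapRingHom (algebraMap K F)) (mapCoeff_dual_map_mul φ) f g

/-- Divisibility by a polynomial over the smaller field can be tested on all coordinates. -/
theorem map_dvd_of_forall_dual {b : K[X]} (hb : b ≠ 0) {f : F[X]}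
    (h : ∀ φ : Module.Dual K F, b ∣ mapCoeff φ.toAddMonoidHom f) :
    b.map (algebraMap K F) ∣ f := by
  set b' := b.map (algebraMap K F) with hb'
  have hb0 : b' ≠ 0 := (Polynomial.map_ne_zero_iff (algebraMap K F).injective).2 hb
  rw [← EuclideanDomain.mod_eq_zero]
  ext i
  rw [coeff_zero, ← Module.forall_dual_apply_eq_zero_iff K]
  intro φ
  have h1 := EuclideanDomain.div_add_mod f b'
  have h2 : b ∣ mapCoeff φ.toAddMonoidHom (f % b') := by
    have h3 := congrArg (mapCoeff φ.toAddMonoidHom) h1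
    rw [map_add, hb', mapCoeff_dual_map_mul] at h3
    rw [← dvd_add_right (Dvd.intro _ rfl), h3]
    exact h φ
  have h4 : mapCoeff φ.toAddMonoidHom (f % b') = 0 := by
    refine eq_zero_of_dvd_of_degree_lt h2 ((degree_mapCoeff_le _ _).trans_lt ?_)
    rw [← degree_map b (algebraMap K F)]
    exact EuclideanDomain.mod_lt f hb0
  have h5 := coeff_mapCoeff φ.toAddMonoidHom (f % b') i
  rw [h4, coeff_zero] at h5
  exact h5.symm

end Dual

end Polynomial

namespace SkewDer

section BaseChange

variable {K F : Type*} [Field K] [Field F] [Algebra K F] {S : SkewDer K[X]} {S' : SkewDer F[X]}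

theorem mapCoeff_lmul_map (hσ : ∀ u : K[X], S'.σ (u.map (algebraMap K F)) =
      (S.σ u).map (algebraMap K F))
    (hδ : ∀ u : K[X], S'.δ (u.map (algebraMap K F)) = (S.δ u).map (algebraMap K F))
    (φ : Module.Dual K F) (Q : F[X][X]) (L : K[X][X]) :
    mapCoeff (mapCoeff φ.toAddMonoidHom) (S'.lmul Q (L.map (mapRingHom (algebraMap K F)))) =
      S.lmul (mapCoeff (mapCoeff φ.toAddMonoidHom) Q) L := by
  induction Q using Polynomial.induction_on' with
  | add p q hp hq => simp only [lmul_add_left, map_add, hp, hq]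
  | monomial k v =>
    rw [lmul_monomial, ← map_iterate_dmul (S := S) (S' := S') hσ hδ, mul_comm,
      mapCoeff_mapCoeff_dual_map_mul, ← monomial_zero_left,
      mapCoeff_monomial, mapCoeff_monomial, lmul_monomial, mul_comm, monomial_zero_left]

theorem IsLeftMultiple.map {R R' : Type*} [CommRing R] [CommRing R'] {S : SkewDer R}
    {S' : SkewDer R'} {φ : R →+* R'} (hφ : Function.Injective φ)
    (hσ : ∀ u, S'.σ (φ u) = φ (S.σ u)) (hδ : ∀ u, S'.δ (φ u) = φ (S.δ u)) {L N : R[X]}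
    (h : S.IsLeftMultiple L N) : S'.IsLeftMultiple (L.map φ) (N.map φ) := by
  obtain ⟨s, hs, P, e⟩ := h
  refine ⟨φ s, (map_ne_zero_iff φ hφ).2 hs, P.map φ, ?_⟩
  rw [← map_lmul hσ hδ, ← e, Polynomial.map_mul, map_C]

/-- An adapted family stays adapted after an extension of the field of constants: the coordinates
of a left multiple with respect to a linear functional `F → K` are left multiples over `K`. -/
theorem IsAdapted.baseChange {L : K[X][X]} (hL : L ≠ 0) {B : ℕ → K[X][X]} (h : S.IsAdapted L B)
    (hσ : ∀ u : K[X], S'.σ (u.map (algebraMap K F)) = (S.σ u).map (algebraMap K F))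
    (hδ : ∀ u : K[X], S'.δ (u.map (algebraMap K F)) = (S.δ u).map (algebraMap K F)) :
    S'.IsAdapted (L.map (mapRingHom (algebraMap K F)))
      (fun i => (B i).map (mapRingHom (algebraMap K F))) := by
  have hinj : Function.Injective (mapRingHom (algebraMap K F)) :=
    Polynomial.map_injective _ (algebraMap K F).injective
  have hLd : (L.map (mapRingHom (algebraMap K F))).natDegree = L.natDegree :=
    natDegree_map_eq_of_injective hinj L
  have hL' : L.map (mapRingHom (algebraMap K F)) ≠ 0 := (Polynomial.map_ne_zero_iff hinj).2 hL
  refine ⟨fun i => (h.isLeftMultiple i).map hinj hσ hδ, fun i => ?_, fun i N hN hd => ?_⟩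
  · rw [hLd]
    exact degree_map_le.trans_lt (h.degree_lt i)
  · obtain ⟨Q, hQ⟩ := hN.exists_prod_mul_eq hL' (i + 1) hd
    rw [hLd] at hd ⊢
    rw [coeff_map]
    refine map_dvd_of_forall_dual (h.coeff_ne_zero hL i) fun φ => ?_
    set lam : K[X] := ∏ j ∈ Finset.range (i + 1), S.σ^[j] L.leadingCoeff with hlam
    have hlam0 : lam ≠ 0 := Finset.prod_ne_zero_iff.2 fun j _ =>
      S.iterate_σ_ne_zero (leadingCoeff_ne_zero.2 hL) j
    have hiter : ∀ (j : ℕ) (u : K[X]), S'.σ^[j] (u.map (algebraMap K F)) =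
        (S.σ^[j] u).map (algebraMap K F) := by
      intro j u
      induction j with
      | zero => rfl
      | succ j ih => simp only [Function.iterate_succ_apply', ih, hσ]
    have hlam' : ∏ j ∈ Finset.range (i + 1),
        S'.σ^[j] (L.map (mapRingHom (algebraMap K F))).leadingCoeff =
          lam.map (algebraMap K F) := by
      rw [hlam, Polynomial.map_prod, leadingCoeff_map_of_injective hinj]
      exact Finset.prod_congr rfl fun j _ => hiter j _
    have h1 : C lam * mapCoeff (mapCoeff φ.toAddMonoidHom) N =
        S.lmul (mapCoeff (mapCoeff φ.toAddMonoidHom) Q) L := by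
      rw [← mapCoeff_lmul_map hσ hδ, ← hQ, hlam', ← mapCoeff_mapCoeff_dual_map_mul, map_C,
        coe_mapRingHom]
    have h2 := h.dvd i _ ⟨lam, hlam0, _, h1⟩ ((degree_mapCoeff_le _ _).trans_lt hd)
    rwa [coeff_mapCoeff] at h2

end BaseChange

end SkewDer

/-! ### Remainders modulo a generic polynomial -/

/-- Irreducible polynomials stay prime after adjoining indeterminates to the field of constants. -/
theorem prime_map_of_isFractionRing {K : Type*} [Field K] (n : ℕ) (F : Type*) [Field F]
    [Algebra K F] [Algebra (MvPolynomial (Fin n) K) F] [IsFractionRing (MvPolynomial (Fin n) K) F]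
    [IsScalarTower K (MvPolynomial (Fin n) K) F] {q : K[X]} (hq : Irreducible q) :
    Prime (q.map (algebraMap K F)) := by
  have hlc : q.leadingCoeff ≠ 0 := leadingCoeff_ne_zero.2 hq.ne_zero
  set q₁ := q * C q.leadingCoeff⁻¹ with hq₁
  have hmonic : q₁.Monic := monic_mul_leadingCoeff_inv hq.ne_zero
  have hu : IsUnit (C q.leadingCoeff⁻¹) := isUnit_C.2 (inv_ne_zero hlc).isUnit
  have hass : Associated q q₁ := associated_mul_unit_right q _ hu
  have hprime : Prime q₁ := hass.prime hq.prime
  -- `K[a][x]` is `K[x][a]`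
  let ε : (MvPolynomial (Fin n) K)[X] ≃+* MvPolynomial (Fin n) K[X] :=
    (MvPolynomial.optionEquivLeft K (Fin n)).toRingEquiv.symm.trans
      (MvPolynomial.optionEquivRight K (Fin n)).toRingEquiv
  have hε : ε (q₁.map (algebraMap K (MvPolynomial (Fin n) K))) = MvPolynomial.C q₁ := by
    have : (ε : _ →+* MvPolynomial (Fin n) K[X]).comp
        (mapRingHom (algebraMap K (MvPolynomial (Fin n) K))) = MvPolynomial.C := by
      refine Polynomial.ringHom_ext (fun a => ?_) ?_
      · have h1 : ε.symm (MvPolynomial.C (C a)) = C (MvPolynomial.C a) := by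
          change MvPolynomial.optionEquivLeft K (Fin n)
            ((MvPolynomial.optionEquivRight K (Fin n)).symm (MvPolynomial.C (C a))) = _
          rw [← MvPolynomial.optionEquivRight_C, AlgEquiv.symm_apply_apply,
            MvPolynomial.optionEquivLeft_C]
        rw [RingHom.comp_apply, coe_mapRingHom, map_C, RingEquiv.coe_toRingHom,
          MvPolynomial.algebraMap_eq, ← h1, RingEquiv.apply_symm_apply]
      · have h1 : ε.symm (MvPolynomial.C X) = X := by
          change MvPolynomial.optionEquivLeft K (Fin n)
            ((MvPolynomial.optionEquivRight K (Fin n)).symm (MvPolynomial.C X)) = _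
          rw [← MvPolynomial.optionEquivRight_X_none, AlgEquiv.symm_apply_apply,
            MvPolynomial.optionEquivLeft_X_none]
        rw [RingHom.comp_apply, coe_mapRingHom, map_X, RingEquiv.coe_toRingHom, ← h1,
          RingEquiv.apply_symm_apply]
    exact RingHom.congr_fun this q₁
  have h2 : Prime (q₁.map (algebraMap K (MvPolynomial (Fin n) K))) := by
    rw [← MulEquiv.prime_iff ε.toMulEquiv]
    change Prime (ε _)
    rw [hε]
    exact (MvPolynomial.prime_C_iff _).2 hprime
  have h3 : Irreducible (q₁.map (algebraMap K F)) := by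
    have := ((hmonic.map _).irreducible_iff_irreducible_map_fraction_map
      (K := F)).1 h2.irreducible
    rwa [Polynomial.map_map, ← IsScalarTower.algebraMap_eq K (MvPolynomial (Fin n) K) F] at this
  exact ((hass.map (mapRingHom (algebraMap K F))).symm).prime h3.prime

/-- Polynomials that are linearly independent over a field `κ` can be separated by evaluation at
points of an infinite subring: there are as many points as polynomials at which no nontrivial
linear combination vanishes. -/
theorem exists_points_of_linearIndependent {K κ : Type*} [Field K] [Infinite K] [Field κ]
    (ι : K →+* κ) {n : ℕ} {w : Fin n → κ[X]} (hw : LinearIndependent κ w) :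
    ∃ t : Fin n → K, ∀ c : Fin n → κ,
      (∀ j, (∑ i, C (c i) * w i).eval (ι (t j)) = 0) → c = 0 := by
  let s : Set (Fin n → κ) := Set.range fun (t : K) i => (w i).eval (ι t)
  have hs : Submodule.span κ s = ⊤ := by
    by_contra hne
    obtain ⟨f, hf, hle⟩ := Submodule.exists_le_ker_of_lt_top _ (lt_top_iff_ne_top.2 hne)
    refine hf ?_
    have h1 : ∀ v, f v = ∑ i, f (Pi.single i 1) * v i := by
      intro v
      conv_lhs => rw [← Finset.univ_sum_single v]
      rw [map_sum]
      refine Finset.sum_congr rfl fun i _ => ?_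
      rw [← mul_one (v i), ← smul_eq_mul, Pi.single_smul, map_smul, smul_eq_mul, mul_comm,
        smul_eq_mul, mul_one]
    have h2 : ∑ i, f (Pi.single i 1) • w i = 0 := by
      refine eq_zero_of_infinite_isRoot _ ((Set.infinite_range_of_injective ι.injective).mono ?_)
      rintro _ ⟨t, rfl⟩
      have h3 : f (fun i => (w i).eval (ι t)) = 0 := hle (Submodule.subset_span ⟨t, rfl⟩)
      rw [h1] at h3
      simpa [IsRoot, eval_finsetSum] using h3
    have h4 := Fintype.linearIndependent_iff.1 hw _ h2
    ext1 i
    ext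
    simp [h4]
  obtain ⟨f, hfs, hspan, -⟩ := Submodule.exists_fun_fin_finrank_span_eq κ s
  have hn : Module.finrank κ (Submodule.span κ s) = n := by
    rw [hs, finrank_top, Module.finrank_fin_fun]
  replace hspan : Submodule.span κ (Set.range f) = ⊤ := hspan.trans hs
  choose t ht using hfs
  refine ⟨fun j => t (Fin.cast hn.symm j), fun c hc => ?_⟩
  have h5 : (Fintype.linearCombination κ c : (Fin n → κ) →ₗ[κ] κ) = 0 := by
    refine LinearMap.ext_on_range hspan fun j => ?_
    have := hc (Fin.cast hn j)
    rw [← ht j]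
    simpa [Fintype.linearCombination_apply, eval_finsetSum, mul_comm] using this
  funext i
  have := LinearMap.congr_fun h5 (Pi.single i 1)
  simpa [Fintype.linearCombination_apply, Pi.single_apply] using this

section Generic

/-- The polynomial `a₀ + a₁ X + ⋯ + aₙ₋₁ X ^ (n - 1) + X ^ n`. -/
noncomputable def monicOfCoeffs {R : Type*} [CommRing R] {n : ℕ} (a : Fin n → R) : R[X] :=
  ∑ i : Fin n, C (a i) * X ^ (i : ℕ) + X ^ n

section

variable {R : Type*} [CommRing R] {n : ℕ}

theorem degree_sum_coeffs_lt (a : Fin n → R) :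
    (∑ i : Fin n, C (a i) * X ^ (i : ℕ)).degree < (n : WithBot ℕ) := by
  refine (degree_sum_le _ _).trans_lt ((Finset.sup_lt_iff (WithBot.bot_lt_coe n)).2 fun i _ => ?_)
  exact (degree_C_mul_X_pow_le _ _).trans_lt (WithBot.coe_lt_coe.2 i.2)

theorem monic_monicOfCoeffs (a : Fin n → R) : (monicOfCoeffs a).Monic := by
  rw [monicOfCoeffs, add_comm]
  exact monic_X_pow_add (degree_sum_coeffs_lt a)

theorem natDegree_monicOfCoeffs [Nontrivial R] (a : Fin n → R) :
    (monicOfCoeffs a).natDegree = n := by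
  rw [monicOfCoeffs, add_comm, natDegree_add_eq_left_of_degree_lt, natDegree_X_pow]
  rw [degree_X_pow]
  exact degree_sum_coeffs_lt a

theorem map_monicOfCoeffs {R' : Type*} [CommRing R'] (f : R →+* R') (a : Fin n → R) :
    (monicOfCoeffs a).map f = monicOfCoeffs (f ∘ a) := by
  simp [monicOfCoeffs, Polynomial.map_sum]

theorem Polynomial.Monic.eq_monicOfCoeffs {A : R[X]} (hA : A.Monic) (hn : A.natDegree = n) :
    A = monicOfCoeffs fun i : Fin n => A.coeff i := by
  rw [monicOfCoeffs, Fin.sum_univ_eq_sum_range (fun i => C (A.coeff i) * X ^ i), ← hn, add_comm]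
  exact hA.as_sum

end

/-- The coefficients of the remainders of `w₀, …, wₙ₋₁` modulo `A`. -/
noncomputable def remainderMatrix {R : Type*} [CommRing R] {n : ℕ} (A : R[X]) (w : Fin n → R[X]) :
    Matrix (Fin n) (Fin n) R :=
  Matrix.of fun i j => (w i %ₘ A).coeff j

theorem vecMul_remainderMatrix {R : Type*} [CommRing R] {n : ℕ} {A : R[X]} (w : Fin n → R[X])
    (c : Fin n → R) (j : Fin n) :
    Matrix.vecMul c (remainderMatrix A w) j = ((∑ i, C (c i) * w i) %ₘ A).coeff j := by
  have h : (∑ i, C (c i) * w i) %ₘ A = ∑ i, C (c i) * (w i %ₘ A) := by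
    have h1 := map_sum (modByMonicHom A) (fun i => C (c i) * w i) Finset.univ
    simp only [← smul_eq_C_mul, map_smul] at h1
    simpa only [← smul_eq_C_mul, modByMonicHom_apply] using h1
  rw [h, finsetSum_coeff]
  simp [Matrix.vecMul, dotProduct, remainderMatrix]

theorem map_remainderMatrix {R R' : Type*} [CommRing R] [CommRing R'] {n : ℕ} (f : R →+* R')
    {A : R[X]} (hA : A.Monic) (w : Fin n → R[X]) :
    f.mapMatrix (remainderMatrix A w) = remainderMatrix (A.map f) fun i => (w i).map f := by
  ext i j
  simp [remainderMatrix, ← map_modByMonic f hA]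

/-- If `w₀, …, wₙ₋₁` are linearly independent, then for suitable points `tⱼ` their remainders modulo
`∏ (X - tⱼ)` are linearly independent. -/
theorem exists_det_remainderMatrix_ne_zero {K κ : Type*} [Field K] [Infinite K] [Field κ]
    (ι : K →+* κ) {n : ℕ} {w : Fin n → κ[X]} (hw : LinearIndependent κ w) :
    ∃ t : Fin n → K, (remainderMatrix ((∏ j, (X - C (t j))).map ι) w).det ≠ 0 := by
  obtain ⟨t, ht⟩ := exists_points_of_linearIndependent ι hw
  refine ⟨t, fun h => ?_⟩
  set A₀ : K[X] := ∏ j, (X - C (t j)) with hA₀'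
  have hA₀ : A₀.Monic := monic_prod_of_monic _ _ fun j _ => monic_X_sub_C _
  have hA₀n : A₀.natDegree = n := by simp [A₀]
  obtain ⟨c, hc0, hc⟩ := Matrix.exists_vecMul_eq_zero_iff.2 h
  refine hc0 (ht c fun l => ?_)
  have hmod : (∑ i, C (c i) * w i) %ₘ (A₀.map ι) = 0 := by
    ext m
    rw [coeff_zero]
    rcases lt_or_ge m n with hm | hm
    · have := congrFun hc ⟨m, hm⟩
      rwa [vecMul_remainderMatrix] at this
    · refine coeff_eq_zero_of_degree_lt ((degree_modByMonic_lt _ (hA₀.map _)).trans_le ?_)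
      rw [hA₀.degree_map, degree_eq_natDegree hA₀.ne_zero, hA₀n]
      exact_mod_cast hm
  rw [modByMonic_eq_zero_iff_dvd (hA₀.map _)] at hmod
  obtain ⟨G, hG⟩ := hmod
  have h0 : A₀.eval (t l) = 0 := by
    rw [hA₀', eval_prod]
    exact Finset.prod_eq_zero (Finset.mem_univ l) (by simp)
  rw [hG, eval_mul, eval_map, eval₂_at_apply, h0, map_zero, zero_mul]

/-- Linear independence over the residue field `K[x] / (q)`, from the corresponding statement about
coefficients in `K[x]`. -/
theorem linearIndependent_map_mk {K : Type*} [Field K] {n : ℕ} {q : K[X]} [Fact (Irreducible q)]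
    {w : Fin n → K[X][X]}
    (hw : ∀ (c : Fin n → K[X]) (G : K[X][X]), ∑ i, C (c i) * w i = C q * G → ∀ i, q ∣ c i) :
    LinearIndependent (AdjoinRoot q) fun i => (w i).map (AdjoinRoot.mk q) := by
  rw [Fintype.linearIndependent_iff]
  intro g hg i
  choose c hc using fun i => AdjoinRoot.mk_surjective (g i)
  have h1 : (∑ i, C (c i) * w i).map (AdjoinRoot.mk q) = 0 := by
    rw [← hg, Polynomial.map_sum]
    refine Finset.sum_congr rfl fun i _ => ?_
    rw [Polynomial.map_mul, map_C, smul_eq_C_mul, ← hc i]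
  have h2 : C q ∣ ∑ i, C (c i) * w i := by
    rw [C_dvd_iff_dvd_coeff]
    intro j
    rw [← AdjoinRoot.mk_eq_zero, ← coeff_map, h1, coeff_zero]
  obtain ⟨G, hG⟩ := h2
  rw [← hc i, AdjoinRoot.mk_eq_zero]
  exact hw c G hG i

variable {K : Type*} [Field K] {n : ℕ} (F : Type*) [Field F] [Algebra K F]
  [Algebra (MvPolynomial (Fin n) K) F] [IsFractionRing (MvPolynomial (Fin n) K) F]
  [IsScalarTower K (MvPolynomial (Fin n) K) F]

/-- Let `w₀, …, wₙ₋₁` be linearly independent modulo `q`. For a generic monic polynomial of degree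
`n`, the determinant of the remainders is not divisible by `q`. Otherwise `q` would divide it for
every choice of constants `a`, also for the coefficients of `∏ (X - tⱼ)`, where the points `tⱼ`
separate the `wᵢ`. -/
theorem not_dvd_det_remainderMatrix [Infinite K] {q : K[X]} (hq : Irreducible q)
    (w : Fin n → K[X][X])
    (hw : ∀ (c : Fin n → K[X]) (G : K[X][X]), ∑ i, C (c i) * w i = C q * G → ∀ i, q ∣ c i) :
    ¬ q.map (algebraMap K F) ∣
      (remainderMatrix (monicOfCoeffs fun i =>
          C (algebraMap (MvPolynomial (Fin n) K) F (MvPolynomial.X i)))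
        (fun i => (w i).map (mapRingHom (algebraMap K F)))).det := by
  intro hdvd
  have : Fact (Irreducible q) := ⟨hq⟩
  obtain ⟨t, ht⟩ := exists_det_remainderMatrix_ne_zero (algebraMap K (AdjoinRoot q))
    (linearIndependent_map_mk hw)
  refine ht ?_
  set A₀ : K[X] := ∏ j, (X - C (t j)) with hA₀'
  have hA₀ : A₀.Monic := monic_prod_of_monic _ _ fun j _ => monic_X_sub_C _
  have hA₀n : A₀.natDegree = n := by simp [A₀]
  -- specialization of the constants `a` to the coefficients of `∏ (X - tⱼ)`
  let ev : MvPolynomial (Fin n) K →+* K := MvPolynomial.eval fun i => A₀.coeff i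
  have hev : ev.comp (algebraMap K (MvPolynomial (Fin n) K)) = RingHom.id K := by
    ext a
    simp [ev, MvPolynomial.algebraMap_eq]
  let ψ : (MvPolynomial (Fin n) K)[X] →+* AdjoinRoot q := (AdjoinRoot.mk q).comp (mapRingHom ev)
  have hψmap : ∀ u : K[X], ψ (u.map (algebraMap K (MvPolynomial (Fin n) K))) =
      AdjoinRoot.mk q u := by
    intro u
    rw [RingHom.comp_apply, coe_mapRingHom, Polynomial.map_map, hev, Polynomial.map_id]
  -- the matrix of remainders has entries in `K[a][x]`
  let A : (MvPolynomial (Fin n) K)[X][X] := monicOfCoeffs fun i => C (MvPolynomial.X i)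
  have hA : A.Monic := monic_monicOfCoeffs _
  let w' : Fin n → (MvPolynomial (Fin n) K)[X][X] :=
    fun i => (w i).map (mapRingHom (algebraMap K (MvPolynomial (Fin n) K)))
  have hAF : A.map (mapRingHom (algebraMap (MvPolynomial (Fin n) K) F)) =
      monicOfCoeffs fun i => C (algebraMap (MvPolynomial (Fin n) K) F (MvPolynomial.X i)) := by
    rw [map_monicOfCoeffs]
    congr 1
    funext i
    rw [Function.comp_apply, coe_mapRingHom, map_C]
  have hwF : ∀ i, (w' i).map (mapRingHom (algebraMap (MvPolynomial (Fin n) K) F)) =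
      (w i).map (mapRingHom (algebraMap K F)) := by
    intro i
    rw [Polynomial.map_map, mapRingHom_comp,
      ← IsScalarTower.algebraMap_eq K (MvPolynomial (Fin n) K) F]
  have hdet : (remainderMatrix (monicOfCoeffs fun i =>
        C (algebraMap (MvPolynomial (Fin n) K) F (MvPolynomial.X i)))
      fun i => (w i).map (mapRingHom (algebraMap K F))).det =
      (remainderMatrix A w').det.map (algebraMap (MvPolynomial (Fin n) K) F) := by
    rw [← coe_mapRingHom (algebraMap (MvPolynomial (Fin n) K) F), RingHom.map_det,
      map_remainderMatrix _ hA, hAF]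
    simp only [hwF]
  -- division by a monic associate of `q` does not leave `K[a][x]`
  have hmonic : (q * C q.leadingCoeff⁻¹).Monic := monic_mul_leadingCoeff_inv hq.ne_zero
  have hu : IsUnit (C q.leadingCoeff⁻¹) :=
    isUnit_C.2 (inv_ne_zero (leadingCoeff_ne_zero.2 hq.ne_zero)).isUnit
  have h1 : (q * C q.leadingCoeff⁻¹).map (algebraMap K (MvPolynomial (Fin n) K)) ∣
      (remainderMatrix A w').det := by
    rw [← Polynomial.map_dvd_map (algebraMap (MvPolynomial (Fin n) K) F)
      (IsFractionRing.injective (MvPolynomial (Fin n) K) F) (hmonic.map _), Polynomial.map_map,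
      ← IsScalarTower.algebraMap_eq K (MvPolynomial (Fin n) K) F, ← hdet, Polynomial.map_mul]
    exact (hu.map (mapRingHom (algebraMap K F))).mul_right_dvd.2 hdvd
  have h2 := map_dvd ψ h1
  rw [hψmap, map_mul, AdjoinRoot.mk_self, zero_mul, zero_dvd_iff, RingHom.map_det,
    map_remainderMatrix ψ hA] at h2
  have hψA : A.map ψ = A₀.map (algebraMap K (AdjoinRoot q)) := by
    conv_rhs => rw [hA₀.eq_monicOfCoeffs hA₀n]
    rw [map_monicOfCoeffs, map_monicOfCoeffs]
    congr 1
    funext i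
    simp only [ψ, ev, Function.comp_apply, RingHom.comp_apply, coe_mapRingHom, map_C,
      MvPolynomial.eval_X, AdjoinRoot.mk_C, AdjoinRoot.algebraMap_eq]
  have hψw : ∀ i, (w' i).map ψ = (w i).map (AdjoinRoot.mk q) := by
    intro i
    rw [Polynomial.map_map]
    congr 1
    exact RingHom.ext hψmap
  rw [hψA] at h2
  simpa only [hψw] using h2

/-- A linear combination, modulo `q`, of operators that are linearly independent modulo `q` is
divisible by a generic polynomial only if it is trivial modulo `q`. -/
theorem dvd_of_generic_dvd [Infinite K] {q : K[X]} (hq : Irreducible q)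
    (w : Fin n → K[X][X])
    (hw : ∀ (c : Fin n → K[X]) (G : K[X][X]), ∑ i, C (c i) * w i = C q * G → ∀ i, q ∣ c i)
    (c : Fin n → F[X]) (G : F[X][X])
    (h : monicOfCoeffs (fun i => C (algebraMap (MvPolynomial (Fin n) K) F (MvPolynomial.X i))) ∣
      ∑ i, C (c i) * (w i).map (mapRingHom (algebraMap K F)) +
        C (q.map (algebraMap K F)) * G) (i : Fin n) :
    q.map (algebraMap K F) ∣ c i := by
  set q' := q.map (algebraMap K F) with hq'
  let A : F[X][X] := monicOfCoeffs fun i =>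
    C (algebraMap (MvPolynomial (Fin n) K) F (MvPolynomial.X i))
  have hA : A.Monic := monic_monicOfCoeffs _
  have hdet := not_dvd_det_remainderMatrix F hq w hw
  have hprime := prime_map_of_isFractionRing n F hq
  let π : F[X] →+* F[X] ⧸ Ideal.span {q'} := Ideal.Quotient.mk _
  have : (Ideal.span {q'}).IsPrime := (Ideal.span_singleton_prime hprime.ne_zero).2 hprime
  have hπ : ∀ u, π u = 0 ↔ q' ∣ u := fun u => by
    rw [Ideal.Quotient.eq_zero_iff_mem, Ideal.mem_span_singleton]
  rw [← hπ] at hdet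
  erw [RingHom.map_det, map_remainderMatrix π hA] at hdet
  rw [← hπ]
  have hzero : Matrix.vecMul (fun i => π (c i))
      (remainderMatrix (A.map π)
        fun i => ((w i).map (mapRingHom (algebraMap K F))).map π) = 0 := by
    funext j
    rw [vecMul_remainderMatrix]
    have h1 : A.map π ∣ ∑ i, C (π (c i)) * ((w i).map (mapRingHom (algebraMap K F))).map π := by
      have h2 := map_dvd (mapRingHom π) h
      rw [coe_mapRingHom, Polynomial.map_add, Polynomial.map_mul, map_C, (hπ q').2 dvd_rfl, C_0,
        zero_mul, add_zero, Polynomial.map_sum] at h2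
      simpa only [Polynomial.map_mul, map_C] using h2
    rw [(modByMonic_eq_zero_iff_dvd (hA.map π)).2 h1, coeff_zero, Pi.zero_apply]
  exact congrFun (Matrix.eq_zero_of_vecMul_eq_zero hdet hzero) i

end Generic

/-! ### Operators with rational coefficients -/

namespace SkewDer

theorem exists_map_eq_C_mul {R : Type*} [CommRing R] [IsDomain R] (Q : Type*) [Field Q]
    [Algebra R Q] [IsFractionRing R Q] (U : Q[X]) :
    ∃ s : R, s ≠ 0 ∧ ∃ P : R[X], P.map (algebraMap R Q) = C (algebraMap R Q s) * U := by
  obtain ⟨b, hb, h⟩ := IsLocalization.integerNormalization_spec (nonZeroDivisors R) U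
  refine ⟨b, nonZeroDivisors.ne_zero hb, _, h.trans ?_⟩
  rw [← algebraMap_smul Q b U, smul_eq_C_mul]

end SkewDer

namespace OreData

section

variable {K : Type*} [Field K] (D : OreData K)

theorem toPoly_toRat (L : D.Alg) :
    (D.toRat L).toPoly = L.toPoly.map (algebraMap K[X] (RatFunc K)) := rfl

theorem toRat_mul (P L : D.Alg) : D.toRat (P * L) = D.toRat P * D.toRat L :=
  OrePoly.ext (SkewDer.map_lmul (D.skewDer.frac_σ_algebraMap (RatFunc K))
    (D.skewDer.frac_δ_algebraMap (RatFunc K)) _ _)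

theorem toRat_injective : Function.Injective D.toRat := fun _ _ h =>
  OrePoly.ext (Polynomial.map_injective _ (IsFractionRing.injective K[X] (RatFunc K))
    (congrArg OrePoly.toPoly h))

theorem natDegree_toRat (L : D.Alg) : (D.toRat L).toPoly.natDegree = L.toPoly.natDegree :=
  natDegree_map_eq_of_injective (IsFractionRing.injective K[X] (RatFunc K)) _

theorem toRat_ne_zero {L : D.Alg} (hL : L ≠ 0) : (D.toRat L).toPoly ≠ 0 := fun h =>
  hL (OrePoly.ext ((Polynomial.map_eq_zero_iff (IsFractionRing.injective K[X] (RatFunc K))).1 h))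

/-- A common denominator for the coefficients of an operator. -/
theorem exists_toRat_eq_coe_mul (U : D.RatAlg) :
    ∃ s : K[X], s ≠ 0 ∧ ∃ P : D.Alg,
      D.toRat P = OrePoly.coe _ (algebraMap K[X] (RatFunc K) s) * U := by
  obtain ⟨s, hs, P, h⟩ := SkewDer.exists_map_eq_C_mul (R := K[X]) (RatFunc K) U.toPoly
  exact ⟨s, hs, ⟨P⟩, OrePoly.ext (h.trans (SkewDer.lmul_C _ _ _).symm)⟩

theorem toRat_coe (s : K[X]) :
    D.toRat (OrePoly.coe D.skewDer s) = OrePoly.coe _ (algebraMap K[X] (RatFunc K) s) :=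
  OrePoly.ext (Polynomial.map_C _)

theorem coe_mul_toPoly (s : K[X]) (L : D.Alg) :
    (OrePoly.coe D.skewDer s * L).toPoly = C s * L.toPoly := SkewDer.lmul_C _ _ _

theorem coe_inv_mul_coe_mul {u : RatFunc K} (hu : u ≠ 0) (N : D.RatAlg) :
    OrePoly.coe _ u⁻¹ * (OrePoly.coe _ u * N) = N := by
  apply OrePoly.ext
  change SkewDer.lmul _ (C u⁻¹) (SkewDer.lmul _ (C u) N.toPoly) = _
  rw [SkewDer.lmul_C, SkewDer.lmul_C, ← mul_assoc, ← C_mul, inv_mul_cancel₀ hu, C_1, one_mul]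

/-- For operators with polynomial coefficients, `IsLeftMultiple` is membership in the left ideal
generated by `L` in `K(x)[∂]`. -/
theorem isLeftMultiple_iff (L N : D.Alg) :
    D.skewDer.IsLeftMultiple L.toPoly N.toPoly ↔ ∃ U : D.RatAlg, U * D.toRat L = D.toRat N := by
  constructor
  · rintro ⟨s, hs, P, h⟩
    have hs' : algebraMap K[X] (RatFunc K) s ≠ 0 :=
      (map_ne_zero_iff _ (IsFractionRing.injective K[X] (RatFunc K))).2 hs
    have h1 : OrePoly.coe D.skewDer s * N = (⟨P⟩ : D.Alg) * L :=
      OrePoly.ext ((D.coe_mul_toPoly s N).trans h)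
    refine ⟨OrePoly.coe _ (algebraMap K[X] (RatFunc K) s)⁻¹ * D.toRat ⟨P⟩, ?_⟩
    rw [mul_assoc, ← toRat_mul, ← h1, toRat_mul, toRat_coe, coe_inv_mul_coe_mul D hs']
  · rintro ⟨U, h⟩
    obtain ⟨s, hs, P, hP⟩ := D.exists_toRat_eq_coe_mul U
    refine ⟨s, hs, P.toPoly, ?_⟩
    have h1 : OrePoly.coe D.skewDer s * N = P * L := by
      apply D.toRat_injective
      rw [toRat_mul, toRat_mul, hP, toRat_coe, mul_assoc, h]
    rw [← coe_mul_toPoly, h1]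
    rfl

theorem order_mul_toRat {U : D.RatAlg} {L N : D.Alg} (hL : L ≠ 0) (hN : N ≠ 0)
    (h : U * D.toRat L = D.toRat N) : N.toPoly.natDegree = L.toPoly.natDegree + U.order := by
  have h0 : SkewDer.lmul _ U.toPoly (D.toRat L).toPoly = (D.toRat N).toPoly :=
    congrArg OrePoly.toPoly h
  have hU : U.toPoly ≠ 0 := SkewDer.left_ne_zero_of_lmul _ (h0 ▸ D.toRat_ne_zero hN)
  have h1 := ((D.skewDer.frac (RatFunc K)).natDegree_leadingCoeff_lmul hU (D.toRat_ne_zero hL)).1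
  rwa [h0, natDegree_toRat, natDegree_toRat] at h1

end

/-! ### Removability and minimal leading coefficients -/

section Removable

variable {K : Type*} [Field K] (D : OreData K)

theorem emultiplicity_iterate_σ (a b : K[X]) (m : ℕ) :
    emultiplicity (D.σ^[m] a) (D.σ^[m] b) = emultiplicity a b := by
  induction m with
  | zero => rfl
  | succ m ih => rw [Function.iterate_succ_apply', Function.iterate_succ_apply',
      emultiplicity_map_eq, ih]

theorem irreducible_iterate_σ {p : K[X]}
    (hp : Irreducible p) (m : ℕ) : Irreducible (D.σ^[m] p) := by
  induction m with
  | zero => exact hp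
  | succ m ih =>
    rw [Function.iterate_succ_apply']
    exact (MulEquiv.irreducible_iff D.σ).2 ih

/-- The multiplicity of `σⁿ(p)` in the minimal leading coefficient of the left multiples of `L` of
order `ord L + n` is what removing `p` from `L` at order `n` leaves over. -/
theorem emultiplicity_coeff_of_isGreatest {L : D.Alg} (hL : L ≠ 0) {B : ℕ → K[X][X]}
    (hB : D.skewDer.IsAdapted L.toPoly B) {n : ℕ} {p : K[X]} (hp : Irreducible p) {e : ℕ}
    (he : emultiplicity p L.lc = e) {k : ℕ}
    (hk : IsGreatest {j : ℕ | j ≤ e ∧ D.Removable L (p ^ j) n} k) :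
    emultiplicity (D.σ^[n] p) ((B n).coeff (L.toPoly.natDegree + n)) = ((e - k : ℕ) : ℕ∞) := by
  have hL' : L.toPoly ≠ 0 := fun h => hL (OrePoly.ext h)
  set b := (B n).coeff (L.toPoly.natDegree + n) with hb
  have hsymm : ∀ u, D.σ.symm^[n] (D.σ^[n] u) = u :=
    Function.LeftInverse.iterate D.σ.symm_apply_apply n
  have hsymm' : ∀ u, D.σ^[n] (D.σ.symm^[n] u) = u :=
    Function.LeftInverse.iterate D.σ.apply_symm_apply n
  have hdvd : ∀ u v, u ∣ v → D.σ.symm^[n] u ∣ D.σ.symm^[n] v := by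
    rintro u _ ⟨v, rfl⟩
    rw [iterate_map_mul]
    exact dvd_mul_right _ _
  set g := D.σ.symm^[n] b with hg
  rw [← hsymm' b, emultiplicity_iterate_σ, ← hg]
  have hgL : g ∣ L.lc := by
    have h1 := hdvd _ _ (hB.dvd_iterate_σ hL' n)
    exact h1.trans (hsymm L.lc).dvd
  have hlc : L.lc ≠ 0 := leadingCoeff_ne_zero.2 hL'
  have hg0 : g ≠ 0 := ne_zero_of_dvd_ne_zero hlc hgL
  obtain ⟨g', hg', hpg'⟩ :=
    (FiniteMultiplicity.of_prime_left hp.prime hg0).exists_eq_pow_mul_and_not_dvd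
  obtain ⟨l', hl', hpl'⟩ :=
    (FiniteMultiplicity.of_prime_left hp.prime hlc).exists_eq_pow_mul_and_not_dvd
  have hfin := FiniteMultiplicity.of_prime_left hp.prime hg0
  have hme : multiplicity p L.lc = e := multiplicity_eq_of_emultiplicity_eq_some he
  set f := multiplicity p g with hf
  rw [hfin.emultiplicity_eq_multiplicity, ← hf]
  rw [hme] at hl'
  have hle : ∀ m, p ^ m ∣ L.lc → m ≤ e := by
    intro m hm
    have := le_emultiplicity_of_pow_dvd hm
    rw [he] at this
    exact_mod_cast this
  have hfe : f ≤ e := hle f ((Dvd.intro _ hg'.symm).trans hgL)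
  -- the operator of minimal leading coefficient removes `p ^ (e - f)`
  have h1 : e - f ≤ k := by
    refine hk.2 ⟨Nat.sub_le e f, ?_, ?_⟩
    · rw [hl']
      exact Dvd.dvd.mul_right (pow_dvd_pow p (Nat.sub_le e f)) _
    · let N : D.Alg := ⟨B n⟩
      have hNlc : N.lc = b := by
        change (B n).leadingCoeff = _
        rw [leadingCoeff, hB.natDegree_eq hL']
      have hN0 : N ≠ 0 := by
        intro h
        exact hB.coeff_ne_zero hL' n (by rw [show B n = 0 from congrArg OrePoly.toPoly h,
          coeff_zero])
      obtain ⟨U, hU⟩ := (D.isLeftMultiple_iff L N).1 (hB.isLeftMultiple n)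
      have hord := D.order_mul_toRat hL hN0 hU
      have hl0 : l' ≠ 0 := by
        rintro rfl
        exact hpl' (dvd_zero p)
      refine ⟨U, N, l', g', ?_, ?_, hl0, ?_, hU, ?_⟩
      · rintro rfl
        rw [zero_mul] at hU
        exact D.toRat_ne_zero hN0 (congrArg OrePoly.toPoly hU).symm
      · change (B n).natDegree = _ at hord
        rw [hB.natDegree_eq hL'] at hord
        omega
      · exact ((Irreducible.coprime_iff_not_dvd hp).2 hpg').pow_left
      · have hden : algebraMap K[X] (RatFunc K) (l' * p ^ (e - f)) ≠ 0 :=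
          (map_ne_zero_iff _ (IsFractionRing.injective K[X] (RatFunc K))).2
            (mul_ne_zero hl0 (pow_ne_zero _ hp.ne_zero))
        rw [hNlc, ← hg, div_mul_eq_mul_div, eq_div_iff hden, ← map_mul, ← map_mul]
        congr 1
        have hpow : p ^ f * p ^ (e - f) = p ^ e := by rw [← pow_add, Nat.add_sub_cancel' hfe]
        rw [hg', hl', ← hpow]
        ring
  -- conversely, the minimal leading coefficient divides that of any operator removing `p ^ k`
  have h2 : f + k ≤ e := by
    rcases Nat.eq_zero_or_pos k with h0 | hpos
    · omega
    · obtain ⟨-, -, P, N, v, w, hP, hPn, hv, hw, hPL, hlcN⟩ := hk.1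
      have hpw : ¬ p ∣ w := (Irreducible.coprime_iff_not_dvd hp).1
        (hw.of_isCoprime_of_dvd_left (dvd_pow_self p hpos.ne'))
      have hvp : v * p ^ k ≠ 0 := mul_ne_zero hv (pow_ne_zero _ hp.ne_zero)
      rw [div_mul_eq_mul_div, eq_div_iff ((map_ne_zero_iff _
        (IsFractionRing.injective K[X] (RatFunc K))).2 hvp), ← map_mul, ← map_mul] at hlcN
      replace hlcN := IsFractionRing.injective K[X] (RatFunc K) hlcN
      have hN0 : N ≠ 0 := by
        rintro rfl
        have h0 : SkewDer.lmul _ P.toPoly (D.toRat L).toPoly = 0 :=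
          (congrArg OrePoly.toPoly hPL).trans (Polynomial.map_zero _)
        exact SkewDer.lmul_ne_zero _ (fun h => hP (OrePoly.ext h)) (D.toRat_ne_zero hL) h0
      have hNd : N.toPoly.natDegree = L.toPoly.natDegree + n := by
        rw [D.order_mul_toRat hL hN0 hPL, hPn]
      have hbN : b ∣ N.lc := by
        have h3 : N.lc = N.toPoly.coeff (L.toPoly.natDegree + n) := by
          rw [← hNd]
          rfl
        rw [h3]
        refine hB.dvd n N.toPoly ((D.isLeftMultiple_iff L N).2 ⟨P, hPL⟩) ?_
        rw [← natDegree_lt_iff_degree_lt (fun h => hN0 (OrePoly.ext h)), hNd]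
        omega
      have hpf : p ^ f ∣ D.σ.symm^[n] N.lc := (Dvd.intro _ hg'.symm).trans (hdvd _ _ hbN)
      refine hle (f + k) (hp.prime.pow_dvd_of_dvd_mul_left _ hpw ?_)
      rw [← hlcN, pow_add]
      exact mul_dvd_mul hpf (dvd_mul_left _ _)
  have h3 : f = e - k := by omega
  rw [h3]

end Removable

end OreData

/-! ### Least common left multiples with an operator with constant coefficients -/

namespace OreData

section Lclm

variable {K : Type*} [Field K] (D : OreData K)

theorem toPoly_d_pow (i : ℕ) : (OrePoly.d D.skewDer ^ i).toPoly = X ^ i := by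
  induction i with
  | zero => rfl
  | succ i ih =>
    rw [pow_succ', OrePoly.toPoly_mul, ih]
    change D.skewDer.lmul X (X ^ i) = _
    rw [SkewDer.lmul_X, ← monomial_one_right_eq_X_pow, SkewDer.dmul_monomial, SkewDer.δ_one,
      map_one, monomial_zero_right, add_zero, monomial_one_right_eq_X_pow]

theorem toPoly_constOp {n : ℕ} (a : Fin n → K) :
    (D.constOp a).toPoly = monicOfCoeffs fun i => C (a i) := by
  have hsum : ∀ (s : Finset (Fin n)) (f : Fin n → D.Alg),
      (∑ i ∈ s, f i).toPoly = ∑ i ∈ s, (f i).toPoly := fun s f =>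
    map_sum (AddMonoidHom.mk' (OrePoly.toPoly : D.Alg → K[X][X]) OrePoly.toPoly_add) f s
  rw [constOp, OrePoly.toPoly_add, toPoly_d_pow, hsum, monicOfCoeffs]
  congr 1
  refine Finset.sum_congr rfl fun i _ => ?_
  rw [coe_mul_toPoly, toPoly_d_pow]

theorem δ_C (c : K) : D.δ (C c) = 0 := by
  have h : D.δ 1 = 0 := D.skewDer.δ_one
  rw [← mul_one (C c), ← smul_eq_C_mul, map_smul, h, smul_zero]

theorem coeff_constOp {n : ℕ} (a : Fin n → K) (i : ℕ) :
    ∃ c : K, (D.constOp a).toPoly.coeff i = C c := by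
  have h : (D.constOp a).toPoly = (monicOfCoeffs a).map C := by
    rw [toPoly_constOp, map_monicOfCoeffs]
    rfl
  exact ⟨_, by rw [h, coeff_map]⟩

theorem toPoly_mul_constOp {n : ℕ} (a : Fin n → K) (V : D.Alg) :
    (V * D.constOp a).toPoly = V.toPoly * (D.constOp a).toPoly := by
  refine SkewDer.lmul_eq_mul_of_const _ (fun i => ?_) (fun i => ?_) _
  · obtain ⟨c, hc⟩ := D.coeff_constOp a i
    rw [hc]
    exact D.σ.commutes c
  · obtain ⟨c, hc⟩ := D.coeff_constOp a i
    rw [hc]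
    exact D.δ_C c

theorem toPoly_mul_toRat_constOp {n : ℕ} (a : Fin n → K) (V : D.RatAlg) :
    (V * D.toRat (D.constOp a)).toPoly = V.toPoly * (D.toRat (D.constOp a)).toPoly := by
  refine SkewDer.lmul_eq_mul_of_const _ (fun i => ?_) (fun i => ?_) _
  · obtain ⟨c, hc⟩ := D.coeff_constOp a i
    rw [toPoly_toRat, coeff_map, hc, SkewDer.frac_σ_algebraMap]
    exact congrArg _ (D.σ.commutes c)
  · obtain ⟨c, hc⟩ := D.coeff_constOp a i
    rw [toPoly_toRat, coeff_map, hc, SkewDer.frac_δ_algebraMap]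
    exact (congrArg _ (D.δ_C c)).trans (map_zero _)

/-- Modulo `A`, the operators `L, ∂L, …, ∂ⁿL` are linearly dependent. -/
theorem exists_monic_dvd_lmul {A : K[X][X]} (hA : A.Monic) (L : K[X][X]) :
    ∃ P : K[X][X], P ≠ 0 ∧ P.natDegree ≤ A.natDegree ∧ A ∣ D.skewDer.lmul P L := by
  have hdep : ¬ LinearIndependent K[X]
      fun i : Fin (A.natDegree + 1) => AdjoinRoot.mk A (D.skewDer.dmul^[i] L) := by
    intro h
    have := (AdjoinRoot.powerBasis' hA).finite
    have h1 := h.fintype_card_le_finrank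
    rw [(AdjoinRoot.powerBasis' hA).finrank, AdjoinRoot.powerBasis'_dim, Fintype.card_fin] at h1
    omega
  obtain ⟨g, hg, i₀, hi₀⟩ := Fintype.not_linearIndependent_iff.1 hdep
  have hcoeff : ∀ j : Fin (A.natDegree + 1),
      (∑ i : Fin (A.natDegree + 1), monomial (i : ℕ) (g i)).coeff j = g j := by
    intro j
    rw [finsetSum_coeff, Finset.sum_eq_single j]
    · rw [coeff_monomial, if_pos rfl]
    · intro i _ hij
      rw [coeff_monomial, if_neg (fun h => hij (Fin.ext h))]
    · intro h
      exact absurd (Finset.mem_univ j) h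
  refine ⟨∑ i : Fin (A.natDegree + 1), monomial (i : ℕ) (g i), ?_, ?_, ?_⟩
  · intro h
    have := hcoeff i₀
    rw [h, coeff_zero] at this
    exact hi₀ this.symm
  · exact natDegree_sum_le_of_forall_le _ _ fun i _ =>
      (natDegree_monomial_le _).trans (Nat.lt_succ_iff.1 i.2)
  · rw [← AdjoinRoot.mk_eq_zero, ← hg]
    have hsum : ∀ s : Finset (Fin (A.natDegree + 1)),
        D.skewDer.lmul (∑ i ∈ s, monomial (i : ℕ) (g i)) L =
          ∑ i ∈ s, C (g i) * D.skewDer.dmul^[i] L := by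
      intro s
      have := map_sum (AddMonoidHom.mk' (fun f => D.skewDer.lmul f L)
        (fun f h => D.skewDer.lmul_add_left f h L))
        (fun i : Fin (A.natDegree + 1) => monomial (i : ℕ) (g i)) s
      simpa only [AddMonoidHom.mk'_apply, SkewDer.lmul_monomial] using this
    rw [hsum, map_sum]
    refine Finset.sum_congr rfl fun i _ => ?_
    rw [← smul_eq_C_mul, AdjoinRoot.smul_mk]

/-- Only a bound for the order is needed: the generic case, in which the bound is attained, follows
from the computation of the leading coefficient. -/
theorem exists_commonLeftMultiple {L : D.Alg} (hL : L ≠ 0) {n : ℕ} (a : Fin n → K) :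
    ∃ N : D.RatAlg, N ≠ 0 ∧ D.IsCommonLeftMultiple N (D.toRat L) (D.toRat (D.constOp a)) ∧
      N.order ≤ L.toPoly.natDegree + n := by
  have hL' : L.toPoly ≠ 0 := fun h => hL (OrePoly.ext h)
  have hA : (D.constOp a).toPoly.Monic := by
    rw [toPoly_constOp]
    exact monic_monicOfCoeffs _
  have hAn : (D.constOp a).toPoly.natDegree = n := by
    rw [toPoly_constOp, natDegree_monicOfCoeffs]
  obtain ⟨P, hP, hPn, V, hV⟩ := D.exists_monic_dvd_lmul hA L.toPoly
  rw [hAn] at hPn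
  have hPL : ((⟨P⟩ : D.Alg) * L).toPoly = D.skewDer.lmul P L.toPoly := OrePoly.toPoly_mul _ _
  generalize hM : (⟨P⟩ : D.Alg) * L = M at hPL
  have hVA : (⟨V⟩ : D.Alg) * D.constOp a = M := by
    apply OrePoly.ext
    rw [toPoly_mul_constOp, hPL, hV, mul_comm]
  have hM0 : M ≠ 0 := fun h => by
    rw [h] at hPL
    exact D.skewDer.lmul_ne_zero hP hL' hPL.symm
  refine ⟨D.toRat M, fun h => D.toRat_ne_zero hM0 (congrArg OrePoly.toPoly h),
    ⟨D.toRat ⟨P⟩, D.toRat ⟨V⟩, ?_, ?_⟩, ?_⟩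
  · rw [← hM, D.toRat_mul]
  · rw [← hVA, D.toRat_mul]
  · rw [OrePoly.order, natDegree_toRat, hPL, (D.skewDer.natDegree_leadingCoeff_lmul hP hL').1]
    omega

/-- A nonzero operator has a multiple by a nonzero rational function that is primitive. -/
theorem exists_isPrimitive_toRat_eq {N : D.RatAlg} (hN : N ≠ 0) :
    ∃ (M : D.Alg) (u : RatFunc K), u ≠ 0 ∧ M ≠ 0 ∧ D.toRat M = OrePoly.coe _ u * N ∧
      M.toPoly.IsPrimitive := by
  obtain ⟨_⟩ := (inferInstance : Nonempty (NormalizedGCDMonoid K[X]))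
  obtain ⟨s, hs, P, hP⟩ := D.exists_toRat_eq_coe_mul N
  have hinj := IsFractionRing.injective K[X] (RatFunc K)
  have hs' : algebraMap K[X] (RatFunc K) s ≠ 0 := (map_ne_zero_iff _ hinj).2 hs
  have hP0 : P.toPoly ≠ 0 := by
    intro h
    have h1 : D.toRat P = 0 := OrePoly.ext (by rw [toPoly_toRat, h, Polynomial.map_zero]; rfl)
    rw [← coe_inv_mul_coe_mul D hs' N, ← hP, h1, mul_zero] at hN
    exact hN rfl
  have hc : P.toPoly.content ≠ 0 := content_eq_zero_iff.not.2 hP0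
  have hc' : algebraMap K[X] (RatFunc K) P.toPoly.content ≠ 0 := (map_ne_zero_iff _ hinj).2 hc
  refine ⟨⟨P.toPoly.primPart⟩,
    (algebraMap K[X] (RatFunc K) P.toPoly.content)⁻¹ * algebraMap K[X] (RatFunc K) s,
    mul_ne_zero (inv_ne_zero hc') hs', ?_, ?_, P.toPoly.isPrimitive_primPart⟩
  · exact fun h => P.toPoly.isPrimitive_primPart.ne_zero (congrArg OrePoly.toPoly h)
  · have h1 : P = OrePoly.coe D.skewDer P.toPoly.content * ⟨P.toPoly.primPart⟩ := by
      apply OrePoly.ext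
      rw [coe_mul_toPoly]
      exact P.toPoly.eq_C_content_mul_primPart
    have h2 : D.toRat ⟨P.toPoly.primPart⟩ =
        OrePoly.coe _ (algebraMap K[X] (RatFunc K) P.toPoly.content)⁻¹ * D.toRat P := by
      have h3 := congrArg D.toRat h1
      rw [toRat_mul, toRat_coe] at h3
      rw [h3, coe_inv_mul_coe_mul D hc']
    rw [h2, hP, ← mul_assoc]
    congr 1
    apply OrePoly.ext
    change SkewDer.lmul _ (C _) (C _) = C _
    rw [SkewDer.lmul_C, C_mul]

theorem order_coe_mul {u : RatFunc K} (hu : u ≠ 0) (N : D.RatAlg) :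
    (OrePoly.coe _ u * N).order = N.order := by
  change (SkewDer.lmul _ (C u) N.toPoly).natDegree = N.toPoly.natDegree
  rw [SkewDer.lmul_C, natDegree_C_mul hu]

theorem exists_isLclm {L : D.Alg} (hL : L ≠ 0) {n : ℕ} (a : Fin n → K) :
    ∃ M, D.IsLclm L (D.constOp a) M := by
  classical
  have hex : ∃ m, ∃ N : D.RatAlg, N ≠ 0 ∧
      D.IsCommonLeftMultiple N (D.toRat L) (D.toRat (D.constOp a)) ∧ N.order = m := by
    obtain ⟨N, h1, h2, -⟩ := D.exists_commonLeftMultiple hL a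
    exact ⟨_, N, h1, h2, rfl⟩
  obtain ⟨N, hN, ⟨U, V, hU, hV⟩, hNo⟩ := Nat.find_spec hex
  obtain ⟨M, u, hu, hM0, hM, hprim⟩ := D.exists_isPrimitive_toRat_eq hN
  refine ⟨M, hM0, ⟨OrePoly.coe _ u * U, OrePoly.coe _ u * V, ?_, ?_⟩, fun N' h1 h2 => ?_, hprim⟩
  · rw [hM, hU, mul_assoc]
  · rw [hM, hV, mul_assoc]
  · have h3 : M.order = Nat.find hex := by
      rw [← hNo, ← D.order_coe_mul hu N, ← hM]
      exact (D.natDegree_toRat M).symm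
    rw [h3]
    exact Nat.find_min' hex ⟨N', h1, h2, rfl⟩

variable {D}

theorem IsLclm.isLeftMultiple {P Q M : D.Alg} (h : D.IsLclm P Q M) :
    D.skewDer.IsLeftMultiple P.toPoly M.toPoly := by
  obtain ⟨-, ⟨U, V, hU, hV⟩, -⟩ := h
  exact (D.isLeftMultiple_iff P M).2 ⟨U, hU.symm⟩

theorem IsLclm.constOp_dvd {L M : D.Alg} {n : ℕ} {a : Fin n → K}
    (h : D.IsLclm L (D.constOp a) M) : monicOfCoeffs (fun i => C (a i)) ∣ M.toPoly := by
  obtain ⟨-, ⟨U, V, hU, hV⟩, -⟩ := h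
  rw [← D.toPoly_constOp, ← Polynomial.map_dvd_map (algebraMap K[X] (RatFunc K))
    (IsFractionRing.injective K[X] (RatFunc K))
    (by rw [toPoly_constOp]; exact monic_monicOfCoeffs _)]
  have h1 := congrArg OrePoly.toPoly hV
  rw [toPoly_mul_toRat_constOp] at h1
  exact Dvd.intro_left _ h1.symm

theorem IsLclm.degree_lt {L M : D.Alg} (hL : L ≠ 0) {n : ℕ} {a : Fin n → K}
    (h : D.IsLclm L (D.constOp a) M) : M.toPoly.degree < (L.toPoly.natDegree + (n + 1) : ℕ) := by
  obtain ⟨N, h1, h2, h3⟩ := D.exists_commonLeftMultiple hL a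
  have h4 : M.toPoly.natDegree ≤ _ := (h.2.2.1 N h1 h2).trans h3
  rw [← natDegree_lt_iff_degree_lt (fun h' => h.1 (OrePoly.ext h'))]
  omega

end Lclm

end OreData

/-! ### The leading coefficient of the least common left multiple -/

section Main

variable {K : Type*} [Field K]

/-- A primitive left multiple of `L` of order at most `ord L + n` that is divisible by the generic
operator of order `n` involves `B n` with a coefficient that is not divisible by `q`; hence `q` has
the same multiplicity in its leading coefficient and in that of `B n`. -/
theorem emultiplicity_leadingCoeff_of_generic_dvd [Infinite K] {n : ℕ} (F : Type*) [Field F]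
    [Algebra K F] [Algebra (MvPolynomial (Fin n) K) F] [IsFractionRing (MvPolynomial (Fin n) K) F]
    [IsScalarTower K (MvPolynomial (Fin n) K) F] {S : SkewDer K[X]} {S' : SkewDer F[X]}
    (hσ : ∀ u : K[X], S'.σ (u.map (algebraMap K F)) = (S.σ u).map (algebraMap K F))
    (hδ : ∀ u : K[X], S'.δ (u.map (algebraMap K F)) = (S.δ u).map (algebraMap K F))
    {L : K[X][X]} (hL : L ≠ 0) {B : ℕ → K[X][X]} (hB : S.IsAdapted L B)
    {q : K[X]} (hq : Irreducible q) {M : F[X][X]}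
    (hM : S'.IsLeftMultiple (L.map (mapRingHom (algebraMap K F))) M)
    (hd : M.degree < (L.natDegree + (n + 1) : ℕ)) (hprim : M.IsPrimitive)
    (hA : monicOfCoeffs (fun i : Fin n =>
      C (algebraMap (MvPolynomial (Fin n) K) F (MvPolynomial.X i))) ∣ M) :
    emultiplicity (q.map (algebraMap K F)) M.leadingCoeff =
      emultiplicity q ((B n).coeff (L.natDegree + n)) := by
  have hinj : Function.Injective (mapRingHom (algebraMap K F)) :=
    Polynomial.map_injective _ (algebraMap K F).injective
  have hL' : L.map (mapRingHom (algebraMap K F)) ≠ 0 := (Polynomial.map_ne_zero_iff hinj).2 hL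
  have hLd : (L.map (mapRingHom (algebraMap K F))).natDegree = L.natDegree :=
    natDegree_map_eq_of_injective hinj L
  have hB' := hB.baseChange hL hσ hδ
  set q' := q.map (algebraMap K F) with hq'
  have hprime : Prime q' := prime_map_of_isFractionRing n F hq
  obtain ⟨c, hc⟩ := hB'.exists_eq_sum hL' (n + 1) hM (by rwa [hLd])
  have hindep : ∀ (c : Fin n → K[X]) (G : K[X][X]), ∑ i, C (c i) * B i = C q * G →
      ∀ i, q ∣ c i := by
    intro c G h i
    have h1 := hB.dvd_of_sum_eq hL hq.ne_zero n
      (c := fun i => if hi : i < n then c ⟨i, hi⟩ else 0) (G := G)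
      (by rw [← h, ← Fin.sum_univ_eq_sum_range (fun i =>
            C (if hi : i < n then c ⟨i, hi⟩ else 0) * B i)]; simp) i i.2
    simpa using h1
  have hcn : ¬ q' ∣ c n := by
    rintro ⟨d, hcd⟩
    have hall : ∀ i < n + 1, q' ∣ c i := by
      intro i hi
      rcases Nat.lt_succ_iff_lt_or_eq.1 hi with hi | rfl
      · refine dvd_of_generic_dvd F hq (fun i : Fin n => B i) hindep (fun i => c i)
          (C d * (B n).map (mapRingHom (algebraMap K F))) ?_ ⟨i, hi⟩
        rw [hc, Finset.sum_range_succ, hcd, C_mul, mul_assoc] at hA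
        rwa [Fin.sum_univ_eq_sum_range (fun i => C (c i) *
          (B i).map (mapRingHom (algebraMap K F)))]
      · exact ⟨d, hcd⟩
    have hqM : C q' ∣ M := by
      rw [hc]
      exact Finset.dvd_sum fun i hi =>
        Dvd.dvd.mul_right (_root_.map_dvd C (hall i (Finset.mem_range.1 hi))) _
    exact hprime.not_isUnit (hprim q' hqM)
  have hcoeff : M.coeff (L.natDegree + n) =
      c n * ((B n).coeff (L.natDegree + n)).map (algebraMap K F) := by
    have h1 := (degree_lt_iff_coeff_zero _ _).1 (hB'.sum_degree_lt n c) (L.natDegree + n)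
      (by rw [hLd])
    rw [hc, Finset.sum_range_succ, coeff_add, h1, zero_add, coeff_C_mul, coeff_map,
      coe_mapRingHom]
  have hne : M.coeff (L.natDegree + n) ≠ 0 := by
    rw [hcoeff]
    refine mul_ne_zero (fun h => hcn (h ▸ dvd_zero q')) ?_
    exact (Polynomial.map_ne_zero_iff (algebraMap K F).injective).2 (hB.coeff_ne_zero hL n)
  have hlead : M.leadingCoeff = M.coeff (L.natDegree + n) := by
    rw [leadingCoeff, natDegree_eq_of_le_of_coeff_ne_zero _ hne]
    rw [← natDegree_lt_iff_degree_lt hprim.ne_zero] at hd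
    omega
  rw [hlead, hcoeff, emultiplicity_mul hprime, emultiplicity_eq_zero.2 hcn, zero_add]
  refine emultiplicity_eq_emultiplicity_iff.2 fun m => ?_
  rw [hq', ← Polynomial.map_pow, Polynomial.map_dvd_map']

end Main

theorem theorem1 {K : Type*} [Field K] [CharZero K] (D : OreData K)
    (L : D.Alg) (hL : L ≠ 0) (n : ℕ)
    (p : K[X]) (hp : Irreducible p) (hpL : p ∣ L.lc)
    (e : ℕ) (he : emultiplicity p L.lc = e)
    (k : ℕ) (hk : IsGreatest {j : ℕ | j ≤ e ∧ D.Removable L (p ^ j) n} k) :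
    (∃ M, (D.baseChange (GenericField K n)).IsLclm (D.toBase (GenericField K n) L)
        ((D.baseChange (GenericField K n)).constOp (genericConst K n)) M) ∧
    ∀ M, (D.baseChange (GenericField K n)).IsLclm (D.toBase (GenericField K n) L)
        ((D.baseChange (GenericField K n)).constOp (genericConst K n)) M →
      emultiplicity ((D.σ^[n] p).map (algebraMap K (GenericField K n))) M.lc =
        ((e - k : ℕ) : ℕ∞) := by
  have hL' : L.toPoly ≠ 0 := fun h => hL (OrePoly.ext h)
  have hinj : Function.Injective (mapRingHom (algebraMap K (GenericField K n))) :=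
    Polynomial.map_injective _ (algebraMap K (GenericField K n)).injective
  have hLF : D.toBase (GenericField K n) L ≠ 0 := fun h =>
    hL' ((Polynomial.map_eq_zero_iff hinj).1 (congrArg OrePoly.toPoly h))
  refine ⟨(D.baseChange (GenericField K n)).exists_isLclm hLF _, fun M hM => ?_⟩
  obtain ⟨B, hB⟩ := SkewDer.exists_isAdapted D.skewDer L.toPoly
  have hq : Irreducible (D.σ^[n] p) := D.irreducible_iterate_σ hp n
  rw [← D.emultiplicity_coeff_of_isGreatest hL hB hp he hk]
  refine emultiplicity_leadingCoeff_of_generic_dvd (GenericField K n) (S' :=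
    (D.baseChange (GenericField K n)).skewDer) (D.baseσ_map _) (D.baseδ_map _) hL' hB hq
    hM.isLeftMultiple ?_ hM.2.2.2 hM.constOp_dvd
  have h := hM.degree_lt hLF
  rwa [show (D.toBase (GenericField K n) L).toPoly.natDegree = L.toPoly.natDegree from
    natDegree_map_eq_of_injective hinj _] at h
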